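/- A configuration on a finite simple connected graph $G$ is a function $C:V(G)\to\mathbb{N}$, of size $|C|=\sum_v C(v)$. A pebbling move removes two pebbles from a vertex and places one pebble on an adjacent vertex. For a vertex $r$, $C$ is $r$-solvable if some finite (possibly empty) sequence of pebbling moves places a pebble on $r$; $\pi(G,r)$ is the minimum $t$ such that every configuration of size $t$ is $r$-solvable, and the pebbling number of $G$ is $\pi(G)=\max_r \pi(G,r)$. For odd $m=2k+1\ge 3$, the Flower snark $J_m$ is the graph with the $4m$ vertices $v_i,x_i,y_i,z_i$, $i\in\{-k,\dots,k\}$, in which $z_i$ is adjacent to $v_i$, $x_i$, $y_i$ for each $i$; the $v_i$ form a cycle $v_{-k}\cdots v_k v_{-k}$; the $x_i$ form a path $x_{-k}\cdots x_k$ and the $y_i$ a path $y_{-k}\cdots y_k$; and $x_k$ is adjacent to $y_{-k}$ and $y_k$ to $x_{-k}$; there are no other edges. Theorem. We have $\pi(J_3)\le 13$, $23\le\pi(J_5)\le 30$, and $41\le\pi(J_7)\le 61$. Moreover, for all $k\ge 3$, with $m=2k+1$, $$2^{k+2}+9\;\le\;\pi(J_m)\;\le\;\left\lfloor \tfrac{9}{5}\,2^{k+2}+2k-\tfrac{18}{5}\right\rfloor+1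 .$$ -/

import Mathlib

section Pebbling

variable {V : Type*}

/-- A pebbling move turns the configuration `C` into `C'`: two pebbles are removed from a vertex `u`
and one pebble is placed on a vertex `w` adjacent to `u`. -/
def PebblingMove (G : SimpleGraph V) (C C' : V → ℕ) : Prop :=
  ∃ u w : V, G.Adj u w ∧ C u = C' u + 2 ∧ C' w = C w + 1 ∧
    ∀ a : V, a ≠ u → a ≠ w → C' a = C a

/-- The configuration `C` is `r`-solvable: after some finite (possibly empty) sequence of pebbling
moves there is a pebble on `r`. -/
def PebblingSolvable (G : SimpleGraph V) (r : V) (C : V → ℕ) : Prop :=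
  ∃ C' : V → ℕ, Relation.ReflTransGen (PebblingMove G) C C' ∧ 1 ≤ C' r

/-- The pebbling number `π(G, r)`: the minimum `t` such that every configuration of size `t` is
`r`-solvable. It is valued in `ℕ∞`, with value `⊤` if there were no such `t`. -/
noncomputable def pebblingNumberAt [Fintype V] (G : SimpleGraph V) (r : V) : ℕ∞ :=
  ⨅ (t : ℕ) (_ : ∀ C : V → ℕ, ∑ v, C v = t → PebblingSolvable G r C), (t : ℕ∞)

/-- The pebbling number `π(G) = max_r π(G, r)`. -/
noncomputable def pebblingNumber [Fintype V] (G : SimpleGraph V) : ℕ∞ :=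
  ⨆ r : V, pebblingNumberAt G r

end Pebbling

/-- The four kinds of vertices of a Flower snark. -/
inductive FlowerKind where
  | v | x | y | z
  deriving DecidableEq

instance : Fintype FlowerKind where
  elems := {.v, .x, .y, .z}
  complete a := by cases a <;> simp

/-- The vertices `v_i, x_i, y_i, z_i`, for integers `-k ≤ i ≤ k`. -/
abbrev FlowerVertex (k : ℕ) : Type := FlowerKind × Finset.Icc (-(k : ℤ)) (k : ℤ)

/-- The edges of the Flower snark `J_m`, `m = 2k + 1`, each listed in one direction. -/
def flowerArc (k : ℕ) : FlowerVertex k → FlowerVertex k → Prop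
  | (.z, i), (.v, j) => i = j
  | (.z, i), (.x, j) => i = j
  | (.z, i), (.y, j) => i = j
  | (.v, i), (.v, j) => (j : ℤ) = i + 1 ∨ ((i : ℤ) = k ∧ (j : ℤ) = -k)
  | (.x, i), (.x, j) => (j : ℤ) = i + 1
  | (.y, i), (.y, j) => (j : ℤ) = i + 1
  | (.x, i), (.y, j) => (i : ℤ) = k ∧ (j : ℤ) = -k
  | (.y, i), (.x, j) => (i : ℤ) = k ∧ (j : ℤ) = -k
  | _, _ => False

/-- The Flower snark `J_m` with `m = 2k + 1` (for `k ≥ 1`). -/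
def flowerSnark (k : ℕ) : SimpleGraph (FlowerVertex k) :=
  SimpleGraph.fromRel (flowerArc k)

/-! ### Moves, postponed moves, potentials, and the weight function lemma. -/

section PebblingTheory

variable {V : Type*} [DecidableEq V] {G : SimpleGraph V}

/-! Upper bounds come from the weight function lemma (`IsPebblingStrategy.sum_le`): if weights at
least double from each vertex to its parent on the way to `r`, an unsolvable configuration has
weight at most the total weight. Summing strategies that jointly put weight at least `c` on every
vertex but `r` bounds the size by total weight over `c` (`IsPebblingStrategy.size_le`). The rotation
of the snark, which exchanges the two paths at the crossing, leaves only the roots `v_0`, `x_0` and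
`z_0`. For `z_0` there is one strategy through each of its three neighbours; for `v_0` and `x_0`
there is a strategy along the root's own cycle or path, its mirror image, and one through `z_0`. The
three size bounds are then compared with the common bound in `unsolvable_size_le_center`.

Lower bounds come from unsolvable configurations: one large stack plus single pebbles. A potential
`W = 2 ^ e` at most doubles along an edge, so moves do not raise the value. The single pebbles are
handled by a set `U` whose vertices have their first pebble uncounted: a move out of `U` may then
cost only one counted pebble, so `W` must not grow there. Where one such potential settles the
matter (`not_solvable_stackConfig`), only the stack counts and it is one short of the value of the
root. This falls short of the claim for `J_5` and `J_7`. There the last moves towards the root are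
traced back (`PebblingCovers.undo`): a pebble wanted on a vertex becomes two wanted on a neighbour,
and each branch of this finite search is refuted by its own potential. -/

theorem pebblingMove_iff {C C' : V → ℕ} :
    PebblingMove G C C' ↔
      ∃ u w, G.Adj u w ∧ C + Pi.single w 1 = C' + Pi.single u 2 := by
  constructor
  · rintro ⟨u, w, h, hu, hw, ho⟩
    refine ⟨u, w, h, funext fun a => ?_⟩
    have := h.ne
    by_cases h1 : a = u
    · subst h1; simp [h.ne, hu]
    · by_cases h2 : a = w
      · subst h2; simp [h.ne', hw]
      · simp [h1, h2, ho a h1 h2]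
  · rintro ⟨u, w, h, he⟩
    refine ⟨u, w, h, ?_, ?_, fun a h1 h2 => ?_⟩
    · simpa [h.ne] using congrFun he u
    · simpa [h.ne'] using (congrFun he w).symm
    · simpa [h1, h2] using (congrFun he a).symm

theorem PebblingMove.add_right {C C' : V → ℕ} (h : PebblingMove G C C') (D : V → ℕ) :
    PebblingMove G (C + D) (C' + D) := by
  obtain ⟨u, w, hadj, he⟩ := pebblingMove_iff.1 h
  exact pebblingMove_iff.2 ⟨u, w, hadj, by rw [add_right_comm, he, add_right_comm]⟩

theorem PebblingSolvable.mono {r : V} {C D : V → ℕ} (h : PebblingSolvable G r C) (hCD : C ≤ D) :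
    PebblingSolvable G r D := by
  obtain ⟨C', hC, hr⟩ := h
  obtain ⟨E, rfl⟩ := exists_add_of_le hCD
  refine ⟨C' + E, ?_, le_add_right hr⟩
  exact Relation.ReflTransGen.lift (· + E) (fun _ _ hm => PebblingMove.add_right hm E) _ _ hC

/-- The configuration `C` can be transformed into one that dominates `N`. -/
def PebblingCovers (G : SimpleGraph V) (C N : V → ℕ) : Prop :=
  ∃ C', Relation.ReflTransGen (PebblingMove G) C C' ∧ N ≤ C'

theorem PebblingSolvable.covers {r : V} {C : V → ℕ} (h : PebblingSolvable G r C) :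
    PebblingCovers G C (Pi.single r 1) := by
  obtain ⟨C', hC, hr⟩ := h
  refine ⟨C', hC, fun a => ?_⟩
  by_cases ha : a = r
  · subst ha; simpa using hr
  · simp [ha]

/-- Induction on the last move. If it lands on `v`, it is the move sought. Otherwise `v` already had
a surplus before it, so an earlier move into `v` can be left out and the last move replayed without
it. -/
theorem exists_undo_move {C C' : V → ℕ} (h : Relation.ReflTransGen (PebblingMove G) C C') {v : V}
    (hv : C v < C' v) :
    ∃ w, G.Adj w v ∧ ∃ D, Relation.ReflTransGen (PebblingMove G) C D ∧
      D + Pi.single v 1 = C' + Pi.single w 2 := by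
  induction h with
  | refl => exact absurd hv (lt_irrefl _)
  | @tail D C' hD hm ih =>
    obtain ⟨a, b, hab, he⟩ := pebblingMove_iff.1 hm
    by_cases hb : b = v
    · subst hb
      exact ⟨a, hab, D, hD, he⟩
    · have hev := congrFun he v
      simp only [Pi.add_apply, Pi.single_apply, if_neg (Ne.symm hb)] at hev
      obtain ⟨w, hw, E, hE, hEe⟩ := ih (by omega)
      -- The replayed move is still legal: leaving out the move into `v` costs a pebble only at `v`,
      -- and if `a = v` then `v` had at least three pebbles, since two leave it and a surplus
      -- remains.
      have hle : Pi.single a 2 ≤ E + Pi.single b 1 := by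
        intro c
        have h1 := congrFun he c
        have h2 := congrFun hEe c
        by_cases hca : c = a
        · subst hca
          by_cases hcv : c = v
          · subst hcv
            simp [Pi.single_apply] at h1 h2 hev ⊢
            omega
          · simp [Pi.single_apply, hab.ne, hcv] at h1 h2 ⊢
            omega
        · simp [hca]
      obtain ⟨F, hF⟩ := exists_add_of_le hle
      rw [add_comm (Pi.single a 2)] at hF
      refine ⟨w, hw, F, hE.tail (pebblingMove_iff.2 ⟨a, b, hab, hF⟩), ?_⟩
      have : F + Pi.single v 1 + Pi.single a 2 = C' + Pi.single w 2 + Pi.single a 2 := by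
        calc F + Pi.single v 1 + Pi.single a 2
            = (E + Pi.single b 1) + Pi.single v 1 := by rw [hF]; abel
          _ = (E + Pi.single v 1) + Pi.single b 1 := by abel
          _ = (D + Pi.single b 1) + Pi.single w 2 := by rw [hEe]; abel
          _ = _ := by rw [he]; abel
      exact add_right_cancel this

/-- If more pebbles are wanted on `v` than are there at the start, then some move that brings a
pebble to `v` from a neighbour `w` can be postponed to the end. -/
theorem PebblingCovers.undo {C N : V → ℕ} (h : PebblingCovers G C N) {v : V} (hv : C v < N v) :
    ∃ w, G.Adj w v ∧
      PebblingCovers G C (fun a => N a - (if a = v then 1 else 0) + if a = w then 2 else 0) := by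
  obtain ⟨C', hC, hN⟩ := h
  obtain ⟨w, hw, D, hD, he⟩ := exists_undo_move hC (hv.trans_le (hN v))
  refine ⟨w, hw, D, hD, fun a => ?_⟩
  have h1 := congrFun he a
  have h2 : N a ≤ C' a := hN a
  have h3 : a = v → 1 ≤ N a := by rintro rfl; omega
  simp only [Pi.add_apply, Pi.single_apply] at h1
  dsimp only
  split_ifs at h1 ⊢ with h4 <;> first | omega | (have := h3 h4; omega)

section Fintype

variable [Fintype V]

/-- The value of a configuration under the weights `W`, where the first pebble of each vertex of `U`
is not counted. -/
def pebblingValue (W : V → ℕ) (U : Finset V) (C : V → ℕ) : ℕ :=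
  ∑ v, W v * (C v - if v ∈ U then 1 else 0)

theorem pebblingValue_mono (W : V → ℕ) (U : Finset V) {C D : V → ℕ} (h : C ≤ D) :
    pebblingValue W U C ≤ pebblingValue W U D :=
  Finset.sum_le_sum fun v _ => Nat.mul_le_mul_left _ (Nat.sub_le_sub_right (h v) _)

/-- The weights `W` at most double along each edge, and do not increase when leaving `U`. -/
def IsPebblingPotential (G : SimpleGraph V) (W : V → ℕ) (U : Finset V) : Prop :=
  ∀ a b, G.Adj a b → W b ≤ if a ∈ U then W a else 2 * W a

theorem IsPebblingPotential.value_le_of_move {W : V → ℕ} {U : Finset V}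
    (h : IsPebblingPotential G W U) {C C' : V → ℕ} (hm : PebblingMove G C C') :
    pebblingValue W U C' ≤ pebblingValue W U C := by
  obtain ⟨u, w, hadj, he⟩ := pebblingMove_iff.1 hm
  have hW := h u w hadj
  -- The moved weight `W w` is booked at `u` on the left and at `w` on the right, so that it cancels
  -- after summation and the comparison is made vertex by vertex.
  have key : ∀ v, W v * (C' v - if v ∈ U then 1 else 0) + (if v = u then W w else 0) ≤
      W v * (C v - if v ∈ U then 1 else 0) + if v = w then W w else 0 := by
    intro v
    have hv := congrFun he v
    simp only [Pi.add_apply, Pi.single_apply] at hv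
    by_cases hvu : v = u
    · subst hvu
      simp only [hadj.ne, if_true, if_false, add_zero] at hv ⊢
      rw [hv]
      -- A marked vertex with exactly two pebbles has only one of them counted, so only the loss of
      -- `W u` is guaranteed, not `2 * W u`.
      by_cases hU : v ∈ U
      · simp only [hU, if_true] at hW ⊢
        calc W v * (C' v - 1) + W w ≤ W v * (C' v - 1) + W v * 1 := by omega
          _ = W v * (C' v - 1 + 1) := by ring
          _ ≤ _ := Nat.mul_le_mul_left _ (by omega)
      · simp only [hU, if_false] at hW ⊢
        simp only [Nat.sub_zero, mul_add]
        omega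
    · by_cases hvw : v = w
      · subst hvw
        simp only [hvu, if_true, if_false, add_zero] at hv ⊢
        rw [← hv]
        calc W v * (C v + 1 - if v ∈ U then 1 else 0)
            ≤ W v * ((C v - if v ∈ U then 1 else 0) + 1) := Nat.mul_le_mul_left _ (by omega)
          _ = _ := by ring
      · simp only [hvu, hvw, if_false, add_zero] at hv ⊢
        rw [hv]
  have := Finset.sum_le_sum fun v (_ : v ∈ Finset.univ) => key v
  simp only [Finset.sum_add_distrib, Finset.sum_ite_eq', Finset.mem_univ, if_true] at this
  exact Nat.le_of_add_le_add_right this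

theorem IsPebblingPotential.value_le {W : V → ℕ} {U : Finset V}
    (h : IsPebblingPotential G W U) {C N : V → ℕ} (hN : PebblingCovers G C N) :
    pebblingValue W U N ≤ pebblingValue W U C := by
  obtain ⟨C', hC, hN⟩ := hN
  refine (pebblingValue_mono W U hN).trans ?_
  clear hN
  induction hC with
  | refl => exact le_rfl
  | tail _ hm ih => exact (h.value_le_of_move hm).trans ih

/-- The weights of a (not necessarily basic) strategy towards `r`: each vertex of positive weight
has a neighbour that is `r` or has at least twice the weight. -/
structure IsPebblingStrategy (G : SimpleGraph V) (r : V) (w : V → ℝ) : Prop where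
  nonneg : ∀ v, 0 ≤ w v
  parent : ∀ v, 0 < w v → ∃ p, G.Adj v p ∧ (p = r ∨ 2 * w v ≤ w p)

/-- The weight function lemma. -/
theorem IsPebblingStrategy.sum_le {r : V} {w : V → ℝ} (h : IsPebblingStrategy G r w) {C : V → ℕ}
    (hC : ¬ PebblingSolvable G r C) : ∑ v, w v * C v ≤ ∑ v, w v := by
  induction hn : ∑ v, C v using Nat.strong_induction_on generalizing C with
  | _ n ih =>
    -- Greedy play: moving a pair to the parent does not lower the weight and keeps the
    -- configuration unsolvable. When no pair is left, every vertex of positive weight carries at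
    -- most one pebble.
    by_cases hbig : ∃ v, 0 < w v ∧ 2 ≤ C v
    · obtain ⟨v, hwv, hv⟩ := hbig
      obtain ⟨p, hadj, hp⟩ := h.parent v hwv
      have hle : Pi.single v 2 ≤ C + Pi.single p 1 := by
        intro a
        by_cases ha : a = v
        · subst ha
          simpa using le_add_right hv
        · simp [ha]
      obtain ⟨D, hD⟩ := exists_add_of_le hle
      rw [add_comm (Pi.single v 2)] at hD
      have hm : PebblingMove G C D := pebblingMove_iff.2 ⟨v, p, hadj, hD⟩
      have hD' : ¬ PebblingSolvable G r D := fun ⟨E, hE, hr⟩ => hC ⟨E, hE.head hm, hr⟩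
      rcases hp with rfl | hp
      · refine absurd ⟨D, .refl, ?_⟩ hD'
        have := congrFun hD p
        simp only [Pi.add_apply, Pi.single_apply, hadj.ne', if_true, if_false] at this
        omega
      · have hsum : ∑ a, C a + 1 = ∑ a, D a + 2 := by
          have := congrArg (fun F : V → ℕ => ∑ a, F a) hD
          simpa [Finset.sum_add_distrib] using this
        have hw : ∑ a, w a * C a + w p = ∑ a, w a * D a + w v * 2 := by
          have := congrArg (fun F : V → ℕ => ∑ a, w a * (F a : ℝ)) hD
          simpa [Finset.sum_add_distrib, mul_add, Pi.single_apply] using this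
        have := ih _ (by omega) hD' rfl
        linarith
    · push Not at hbig
      refine Finset.sum_le_sum fun v _ => ?_
      rcases (h.nonneg v).eq_or_lt with h0 | h0
      · simp [← h0]
      · have : C v ≤ 1 := Nat.lt_succ_iff.1 (hbig v h0)
        have : (C v : ℝ) ≤ 1 := by exact_mod_cast this
        nlinarith

/-- The weight function lemma is added up over the strategies. The root may stay uncovered because
an unsolvable configuration has no pebble there. -/
theorem IsPebblingStrategy.size_le {ι : Type*} (s : Finset ι) {r : V} {w : ι → V → ℝ}
    (h : ∀ i ∈ s, IsPebblingStrategy G r (w i)) {c : ℝ}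
    (hcover : ∀ v, v ≠ r → c ≤ ∑ i ∈ s, w i v) {C : V → ℕ} (hC : ¬ PebblingSolvable G r C) :
    c * ∑ v, (C v : ℝ) ≤ ∑ i ∈ s, ∑ v, w i v := by
  have hr : C r = 0 := by
    by_contra h0
    exact hC ⟨C, .refl, Nat.one_le_iff_ne_zero.2 h0⟩
  calc c * ∑ v, (C v : ℝ) = ∑ v, c * C v := Finset.mul_sum ..
    _ ≤ ∑ v, (∑ i ∈ s, w i v) * C v := by
        refine Finset.sum_le_sum fun v _ => ?_
        by_cases hv : v = r
        · simp [hv, hr]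
        · exact mul_le_mul_of_nonneg_right (hcover v hv) (Nat.cast_nonneg _)
    _ = ∑ i ∈ s, ∑ v, w i v * C v := by
        simp only [Finset.sum_mul]
        exact Finset.sum_comm
    _ ≤ _ := Finset.sum_le_sum fun i hi => (h i hi).sum_le hC

end Fintype

end PebblingTheory

theorem PebblingSolvable.comp_iso {V : Type*} {G : SimpleGraph V} (e : G ≃g G) {r : V} {C : V → ℕ}
    (h : PebblingSolvable G r (C ∘ e)) : PebblingSolvable G (e r) C := by
  obtain ⟨C', hC, hr⟩ := h
  refine ⟨C' ∘ e.symm, ?_, by simpa using hr⟩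
  have := Relation.ReflTransGen.lift (p := PebblingMove G) (· ∘ e.symm) (fun A B hm => ?_) _ _ hC
  · simpa [Function.comp_def, Function.onFun] using this
  · obtain ⟨u, w, hadj, hu, hw, ho⟩ := hm
    refine ⟨e u, e w, e.map_adj_iff.2 hadj, by simpa, by simpa, fun a h1 h2 => ?_⟩
    refine ho _ ?_ ?_
    · rintro rfl; exact h1 (by simp)
    · rintro rfl; exact h2 (by simp)

/-! ### Bounding the pebbling number by single configurations. -/

section PebblingNumber

variable {V : Type*} [Fintype V] {G : SimpleGraph V}

theorem pebblingNumber_le {t : ℕ}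
    (h : ∀ r, ∀ C : V → ℕ, ∑ v, C v = t → PebblingSolvable G r C) : pebblingNumber G ≤ t :=
  iSup_le fun r => iInf₂_le t (h r)

theorem exists_le_sum_eq (C : V → ℕ) {t : ℕ} (ht : t ≤ ∑ v, C v) :
    ∃ D ≤ C, ∑ v, D v = t := by
  classical
  induction hn : ∑ v, C v generalizing C with
  | zero => exact ⟨C, le_rfl, by omega⟩
  | succ n ih =>
    by_cases htn : t = n + 1
    · exact ⟨C, le_rfl, by omega⟩
    · obtain ⟨v, -, hv⟩ := Finset.exists_ne_zero_of_sum_ne_zero (by omega : ∑ v, C v ≠ 0)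
      have hle : Pi.single v 1 ≤ C := by
        intro a
        by_cases ha : a = v
        · subst ha; simpa using Nat.one_le_iff_ne_zero.2 hv
        · simp [ha]
      obtain ⟨E, rfl⟩ := exists_add_of_le hle
      have hE : ∑ v, E v = n := by
        simp only [Pi.add_apply, Finset.sum_add_distrib, Finset.sum_pi_single', Finset.mem_univ,
          if_true] at hn
        omega
      obtain ⟨D, hD, hDt⟩ := ih E (by omega) hE
      exact ⟨D, hD.trans le_add_self, hDt⟩

/-- Any size `s < t` is attained by a configuration below `C`; were it solvable, so would `C` be by
monotonicity. -/
theorem le_pebblingNumber {r : V} {C : V → ℕ} (hC : ¬ PebblingSolvable G r C) {t : ℕ}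
    (ht : t ≤ ∑ v, C v + 1) : (t : ℕ∞) ≤ pebblingNumber G := by
  classical
  refine le_trans ?_ (le_iSup _ r)
  refine le_iInf₂ fun s hs => ?_
  by_contra! hlt
  have hst : s < t := by exact_mod_cast hlt
  obtain ⟨D, hD, hDs⟩ := exists_le_sum_eq C (by omega : s ≤ ∑ v, C v)
  exact hC ((hs D hDs).mono hD)

end PebblingNumber

/-! ### Adjacency, rotation and reflection of the Flower snark. -/

section FlowerAdjacency

variable {k : ℕ}

theorem flowerSnark_adj_of_arc (hk : 1 ≤ k) {a b : FlowerVertex k} (h : flowerArc k a b) :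
    (flowerSnark k).Adj a b := by
  refine (SimpleGraph.fromRel_adj _ _ _).2 ⟨?_, Or.inl h⟩
  rintro rfl
  obtain ⟨t, i, hi⟩ := a
  rw [Finset.mem_Icc] at hi
  cases t <;> simp [flowerArc] at h
  omega

theorem flowerSnark_adj_iff (hk : 1 ≤ k) {a b : FlowerVertex k} :
    (flowerSnark k).Adj a b ↔ flowerArc k a b ∨ flowerArc k b a :=
  ⟨fun h => ((SimpleGraph.fromRel_adj _ _ _).1 h).2,
    fun h => h.elim (flowerSnark_adj_of_arc hk) fun h => (flowerSnark_adj_of_arc hk h).symm⟩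

/-- The exchange of the `x` and the `y` vertices. -/
def FlowerKind.swap : FlowerKind → FlowerKind
  | .v => .v
  | .x => .y
  | .y => .x
  | .z => .z

theorem FlowerKind.swap_swap (t : FlowerKind) : t.swap.swap = t := by cases t <;> rfl

/-- The rotation `i ↦ i + 1` of the Flower snark, on vertices. -/
def flowerRotateFun (k : ℕ) (a : FlowerVertex k) : FlowerVertex k :=
  if h : (a.2 : ℤ) < k then
    (a.1, ⟨a.2 + 1, by have := Finset.mem_Icc.1 a.2.2; exact Finset.mem_Icc.2 (by omega)⟩)
  else (a.1.swap, ⟨-k, Finset.mem_Icc.2 (by omega)⟩)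

/-- The rotation `i ↦ i - 1` of the Flower snark, on vertices. -/
def flowerUnrotateFun (k : ℕ) (a : FlowerVertex k) : FlowerVertex k :=
  if h : -(k : ℤ) < a.2 then
    (a.1, ⟨a.2 - 1, by have := Finset.mem_Icc.1 a.2.2; exact Finset.mem_Icc.2 (by omega)⟩)
  else (a.1.swap, ⟨k, Finset.mem_Icc.2 (by omega)⟩)

theorem flowerUnrotateFun_flowerRotateFun (a : FlowerVertex k) :
    flowerUnrotateFun k (flowerRotateFun k a) = a := by
  obtain ⟨t, i, hi⟩ := a
  have hi' := Finset.mem_Icc.1 hi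
  by_cases h : i < k
  · have h' : -(k : ℤ) < i + 1 := by omega
    simp [flowerRotateFun, flowerUnrotateFun, h, h']
  · have : i = k := by omega
    simp [flowerRotateFun, flowerUnrotateFun, FlowerKind.swap_swap, this]

theorem flowerRotateFun_flowerUnrotateFun (a : FlowerVertex k) :
    flowerRotateFun k (flowerUnrotateFun k a) = a := by
  obtain ⟨t, i, hi⟩ := a
  have hi' := Finset.mem_Icc.1 hi
  by_cases h : -(k : ℤ) < i
  · have h' : i - 1 < k := by omega
    simp [flowerRotateFun, flowerUnrotateFun, h, h']
  · have : i = -k := by omega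
    simp [flowerRotateFun, flowerUnrotateFun, FlowerKind.swap_swap, this]

theorem flowerRotateFun_arc (hk : 1 ≤ k) {a b : FlowerVertex k} (h : flowerArc k a b) :
    (flowerSnark k).Adj (flowerRotateFun k a) (flowerRotateFun k b) := by
  obtain ⟨t, i, hi⟩ := a
  obtain ⟨t', j, hj⟩ := b
  have hi' := Finset.mem_Icc.1 hi
  have hj' := Finset.mem_Icc.1 hj
  rw [flowerSnark_adj_iff hk]
  cases t <;> cases t' <;> simp only [flowerArc, Subtype.mk.injEq] at h <;>
    simp only [flowerRotateFun] <;> split_ifs <;>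
    simp only [flowerArc, FlowerKind.swap, Subtype.mk.injEq, or_false, and_true] <;> omega

theorem flowerUnrotateFun_arc (hk : 1 ≤ k) {a b : FlowerVertex k} (h : flowerArc k a b) :
    (flowerSnark k).Adj (flowerUnrotateFun k a) (flowerUnrotateFun k b) := by
  obtain ⟨t, i, hi⟩ := a
  obtain ⟨t', j, hj⟩ := b
  have hi' := Finset.mem_Icc.1 hi
  have hj' := Finset.mem_Icc.1 hj
  rw [flowerSnark_adj_iff hk]
  cases t <;> cases t' <;> simp only [flowerArc, Subtype.mk.injEq] at h <;>
    simp only [flowerUnrotateFun] <;> split_ifs <;>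
    simp only [flowerArc, FlowerKind.swap, Subtype.mk.injEq, or_false, true_and] <;> omega

/-- The rotation `i ↦ i + 1` of the Flower snark. -/
def flowerRotate (hk : 1 ≤ k) : flowerSnark k ≃g flowerSnark k where
  toFun := flowerRotateFun k
  invFun := flowerUnrotateFun k
  left_inv := flowerUnrotateFun_flowerRotateFun
  right_inv := flowerRotateFun_flowerUnrotateFun
  map_rel_iff' := by
    intro a b
    constructor
    · intro h
      rcases (flowerSnark_adj_iff hk).1 h with h | h
      · simpa [flowerUnrotateFun_flowerRotateFun] using flowerUnrotateFun_arc hk h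
      · simpa [flowerUnrotateFun_flowerRotateFun] using (flowerUnrotateFun_arc hk h).symm
    · intro h
      rcases (flowerSnark_adj_iff hk).1 h with h | h
      · exact flowerRotateFun_arc hk h
      · exact (flowerRotateFun_arc hk h).symm

/-- The reflection `i ↦ -i` of the Flower snark, on vertices. -/
def flowerReflectFun (k : ℕ) (a : FlowerVertex k) : FlowerVertex k :=
  (a.1, ⟨-a.2, by have := Finset.mem_Icc.1 a.2.2; exact Finset.mem_Icc.2 (by omega)⟩)

theorem flowerReflectFun_flowerReflectFun (a : FlowerVertex k) :
    flowerReflectFun k (flowerReflectFun k a) = a := by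
  simp [flowerReflectFun]

theorem flowerReflectFun_adj (hk : 1 ≤ k) {a b : FlowerVertex k} (h : (flowerSnark k).Adj a b) :
    (flowerSnark k).Adj (flowerReflectFun k a) (flowerReflectFun k b) := by
  obtain ⟨t, i, hi⟩ := a
  obtain ⟨t', j, hj⟩ := b
  rw [flowerSnark_adj_iff hk] at h ⊢
  cases t <;> cases t' <;>
    simp only [flowerArc, flowerReflectFun, Subtype.mk.injEq, or_false, false_or] at h ⊢ <;> omega

/-- The reflection `i ↦ -i` of the Flower snark. -/
def flowerReflect (hk : 1 ≤ k) : flowerSnark k ≃g flowerSnark k where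
  toFun := flowerReflectFun k
  invFun := flowerReflectFun k
  left_inv := flowerReflectFun_flowerReflectFun
  right_inv := flowerReflectFun_flowerReflectFun
  map_rel_iff' := by
    intro a b
    constructor
    · intro h
      simpa [flowerReflectFun_flowerReflectFun] using flowerReflectFun_adj hk h
    · exact flowerReflectFun_adj hk

/-- The vertex `0` of a given kind. -/
def flowerCenter (k : ℕ) (t : FlowerKind) : FlowerVertex k :=
  (t, ⟨0, Finset.mem_Icc.2 (by omega)⟩)

/-- A rotation-invariant property that holds for `v_0`, `x_0` and `z_0` holds for all vertices. -/
theorem flowerVertex_induction {p : FlowerVertex k → Prop}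
    (hrot : ∀ a, p (flowerRotateFun k a) ↔ p a) (hv : p (flowerCenter k .v))
    (hx : p (flowerCenter k .x)) (hz : p (flowerCenter k .z)) (a : FlowerVertex k) : p a := by
  have step : ∀ (t : FlowerKind) (n : ℕ) (hn : (n : ℤ) - k ∈ Finset.Icc (-(k : ℤ)) k),
      p (t, ⟨n - k, hn⟩) ↔ p (t, ⟨-k, Finset.mem_Icc.2 (by omega)⟩) := by
    intro t n
    induction n with
    | zero => intro hn; simp
    | succ n ih =>
      intro hn
      have h := Finset.mem_Icc.1 hn
      rw [← ih (Finset.mem_Icc.2 (by omega)), ← hrot]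
      have h' : (n : ℤ) - k < k := by omega
      have : flowerRotateFun k (t, ⟨(n : ℤ) - k, Finset.mem_Icc.2 (by omega)⟩) =
          (t, ⟨((n + 1 : ℕ) : ℤ) - k, hn⟩) := by
        simp only [flowerRotateFun, h', dif_pos, Prod.mk.injEq, Subtype.mk.injEq, true_and]
        push_cast
        ring
      rw [← this, hrot, hrot]
  have all : ∀ (t : FlowerKind) (i : ℤ) (hi : i ∈ Finset.Icc (-(k : ℤ)) k),
      p (t, ⟨i, hi⟩) ↔ p (flowerCenter k t) := by
    intro t i hi
    have hi' := Finset.mem_Icc.1 hi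
    have h1 := step t (i + k).toNat (Finset.mem_Icc.2 (by omega))
    have h2 := step t k (Finset.mem_Icc.2 (by omega))
    have e1 : (((i + k).toNat : ℕ) : ℤ) - k = i := by omega
    simp only [e1, sub_self] at h1 h2
    exact h1.trans h2.symm
  obtain ⟨t, i, hi⟩ := a
  rw [all]
  cases t with
  | v => exact hv
  | x => exact hx
  | z => exact hz
  | y =>
    -- Rotating past the crossing turns `x_k` into `y_{-k}`, so the `x` and `y` vertices form a
    -- single orbit.
    have h := hrot (.x, ⟨k, Finset.mem_Icc.2 (by omega)⟩)
    have e : flowerRotateFun k (.x, ⟨(k : ℤ), Finset.mem_Icc.2 (by omega)⟩) =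
        (.y, ⟨-k, Finset.mem_Icc.2 (by omega)⟩) := by
      simp [flowerRotateFun, FlowerKind.swap]
    rw [e] at h
    exact (all _ _ _).1 (h.2 ((all _ _ _).2 hx))

end FlowerAdjacency

/-! ### Strategies as functions of a kind and an integer, and their sums. -/

section FlowerStrategies

variable {k : ℕ}

/-- Spokes, steps along the paths and the crossing of the two paths, in terms of integers. -/
inductive FlowerEdge (k : ℕ) : FlowerKind → ℤ → FlowerKind → ℤ → Prop
  | hub (t : FlowerKind) (j : ℤ) : t ≠ .z → FlowerEdge k t j .z j
  | spoke (t : FlowerKind) (j : ℤ) : t ≠ .z → FlowerEdge k .z j t j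
  | step (t : FlowerKind) (i j : ℤ) :
      t ≠ .z → (j = i + 1 ∨ i = j + 1) → -(k : ℤ) ≤ j → j ≤ k → FlowerEdge k t i t j
  | crossXY (i j : ℤ) : i.natAbs = k → j = -i → FlowerEdge k .x i .y j
  | crossYX (i j : ℤ) : i.natAbs = k → j = -i → FlowerEdge k .y i .x j

theorem FlowerEdge.exists_adj (hk : 1 ≤ k) {t t' : FlowerKind} {i j : ℤ}
    (h : FlowerEdge k t i t' j) (hi : i ∈ Finset.Icc (-(k : ℤ)) k) :
    ∃ hj : j ∈ Finset.Icc (-(k : ℤ)) k, (flowerSnark k).Adj (t, ⟨i, hi⟩) (t', ⟨j, hj⟩) := by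
  have hi' := Finset.mem_Icc.1 hi
  cases h with
  | hub _ _ ht =>
    refine ⟨hi, (flowerSnark_adj_iff hk).2 ?_⟩
    cases t <;> simp_all [flowerArc]
  | spoke _ _ ht =>
    refine ⟨hi, (flowerSnark_adj_iff hk).2 ?_⟩
    cases t' <;> simp_all [flowerArc]
  | step _ _ _ ht hij h1 h2 =>
    refine ⟨Finset.mem_Icc.2 ⟨h1, h2⟩, (flowerSnark_adj_iff hk).2 ?_⟩
    cases t
    case z => exact absurd rfl ht
    all_goals
      simp only [flowerArc]
      omega
  | crossXY _ _ h1 h2 =>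
    refine ⟨Finset.mem_Icc.2 (by omega), (flowerSnark_adj_iff hk).2 ?_⟩
    simp only [flowerArc]
    omega
  | crossYX _ _ h1 h2 =>
    refine ⟨Finset.mem_Icc.2 (by omega), (flowerSnark_adj_iff hk).2 ?_⟩
    simp only [flowerArc]
    omega

theorem isPebblingStrategy_flower (hk : 1 ≤ k) {f : FlowerKind → ℤ → ℝ} {t₀ : FlowerKind}
    (hf : ∀ t j, -(k : ℤ) ≤ j → j ≤ k → 0 ≤ f t j)
    (hp : ∀ t j, -(k : ℤ) ≤ j → j ≤ k → 0 < f t j →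
      ∃ t' j', FlowerEdge k t j t' j' ∧ (t' = t₀ ∧ j' = 0 ∨ 2 * f t j ≤ f t' j')) :
    IsPebblingStrategy (flowerSnark k) (flowerCenter k t₀) (fun a => f a.1 a.2) where
  nonneg := by
    rintro ⟨t, j, hj⟩
    have := Finset.mem_Icc.1 hj
    exact hf t j this.1 this.2
  parent := by
    rintro ⟨t, j, hj⟩ hpos
    have hj' := Finset.mem_Icc.1 hj
    obtain ⟨t', j', he, h⟩ := hp t j hj'.1 hj'.2 hpos
    obtain ⟨hj'', hadj⟩ := he.exists_adj hk hj
    refine ⟨_, hadj, h.imp_left ?_⟩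
    rintro ⟨rfl, rfl⟩
    rfl

/-- The weight `2 ^ (k - |j|)`. -/
noncomputable def flowerPow (k : ℕ) (j : ℤ) : ℝ := 2 ^ (k - j.natAbs)

theorem flowerPow_pos (j : ℤ) : 0 < flowerPow k j := by unfold flowerPow; positivity

theorem one_le_flowerPow (j : ℤ) : 1 ≤ flowerPow k j := one_le_pow₀ one_le_two

theorem flowerPow_le (j : ℤ) : flowerPow k j ≤ 2 ^ k :=
  pow_le_pow_right₀ one_le_two (Nat.sub_le _ _)

theorem flowerPow_zero : flowerPow k 0 = 2 ^ k := by simp [flowerPow]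

theorem flowerPow_neg (j : ℤ) : flowerPow k (-j) = flowerPow k j := by simp [flowerPow]

theorem flowerPow_of_natAbs {j : ℤ} (h : j.natAbs = k) : flowerPow k j = 1 := by
  simp [flowerPow, h]

theorem flowerPow_step {i j : ℤ} (h : j.natAbs = i.natAbs + 1) (hj : j.natAbs ≤ k) :
    flowerPow k i = 2 * flowerPow k j := by
  unfold flowerPow
  rw [← pow_succ', show k - i.natAbs = k - j.natAbs + 1 by omega]

theorem two_le_flowerPow {j : ℤ} (h : j.natAbs < k) : 2 ≤ flowerPow k j := by
  have := one_le_flowerPow (k := k) (j.natAbs + 1)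
  have := flowerPow_step (k := k) (i := j) (j := j.natAbs + 1) (by omega) (by omega)
  linarith

theorem two_mul_flowerPow_le {j : ℤ} (h : j ≠ 0) (hj : j.natAbs ≤ k) :
    2 * flowerPow k j ≤ 2 ^ k := by
  rw [← flowerPow_step (k := k) (i := j.natAbs - 1) (by omega) hj]
  exact flowerPow_le _

theorem exists_flowerPow_parent {j : ℤ} (h : j ≠ 0) (hj : j.natAbs ≤ k) :
    ∃ i, (i = j + 1 ∨ j = i + 1) ∧ -(k : ℤ) ≤ i ∧ i ≤ k ∧ i.natAbs < k ∧
      flowerPow k i = 2 * flowerPow k j := by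
  rcases lt_or_gt_of_ne h with h | h
  · exact ⟨j + 1, by omega, by omega, by omega, by omega, flowerPow_step (by omega) hj⟩
  · exact ⟨j - 1, by omega, by omega, by omega, by omega, flowerPow_step (by omega) hj⟩

theorem sum_flowerVertex {M : Type*} [AddCommMonoid M] (f : FlowerKind → ℤ → M) :
    ∑ a : FlowerVertex k, f a.1 a.2 =
      ∑ j ∈ Finset.Icc (-(k : ℤ)) k, (f .v j + f .x j + f .y j + f .z j) := by
  have hu : (Finset.univ : Finset FlowerKind) = {.v, .x, .y, .z} := rfl
  rw [Fintype.sum_prod_type, hu]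
  simp only [Finset.sum_add_distrib, Finset.sum_coe_sort (Finset.Icc (-(k : ℤ)) k) (f _)]
  simp [add_assoc]

theorem sum_Icc_neg_self (g : ℤ → ℝ) (k : ℕ) :
    ∑ j ∈ Finset.Icc (-(k : ℤ)) k, g j =
      g 0 + ∑ i ∈ Finset.range k, (g (i + 1) + g (-(i + 1))) := by
  induction k with
  | zero => simp
  | succ k ih =>
    have : Finset.Icc (-((k + 1 : ℕ) : ℤ)) ((k + 1 : ℕ) : ℤ) =
        insert ((k : ℤ) + 1) (insert (-((k : ℤ) + 1)) (Finset.Icc (-(k : ℤ)) k)) := by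
      ext j
      simp only [Finset.mem_Icc, Finset.mem_insert]
      omega
    rw [this, Finset.sum_insert, Finset.sum_insert, ih, Finset.sum_range_succ]
    · ring
    · simp only [Finset.mem_Icc]; omega
    · simp only [Finset.mem_Icc, Finset.mem_insert]; omega

/-- The index stops before `|j| = n + 1` because every strategy treats the two ends separately. -/
theorem sum_flowerPow (n : ℕ) :
    ∑ i ∈ Finset.range n, flowerPow (n + 1) (i + 1) = 2 ^ (n + 1) - 2 := by
  have h : ∀ i ∈ Finset.range n, flowerPow (n + 1) (i + 1) = 2 * 2 ^ (n - 1 - i) := by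
    intro i hi
    have := Finset.mem_range.1 hi
    unfold flowerPow
    rw [← pow_succ']
    congr 1
    omega
  rw [Finset.sum_congr rfl h, ← Finset.mul_sum,
    Finset.sum_range_reflect (fun i => (2 : ℝ) ^ i) n, geom_sum_eq (by norm_num)]
  ring

/-- The sum of a function that depends only on `|j|` in the range `0 < |j| < n + 1`. -/
theorem sum_flowerVertex_eq (n : ℕ) (f : FlowerKind → ℤ → ℝ) (a b : ℝ)
    (h : ∀ j : ℤ, 0 < j → j ≤ n →
      (f .v j + f .x j + f .y j + f .z j) + (f .v (-j) + f .x (-j) + f .y (-j) + f .z (-j)) =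
        a + b * flowerPow (n + 1) j) :
    ∑ v : FlowerVertex (n + 1), f v.1 v.2 =
      (f .v 0 + f .x 0 + f .y 0 + f .z 0) + (n * a + b * (2 ^ (n + 1) - 2)) +
      (f .v (n + 1) + f .x (n + 1) + f .y (n + 1) + f .z (n + 1)) +
      (f .v (-(n + 1)) + f .x (-(n + 1)) + f .y (-(n + 1)) + f .z (-(n + 1))) := by
  rw [sum_flowerVertex, sum_Icc_neg_self, Finset.sum_range_succ, ← sum_flowerPow, Finset.mul_sum]
  rw [Finset.sum_congr rfl fun i (hi : i ∈ Finset.range n) =>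
    h ((i : ℤ) + 1) (by omega) (by have := Finset.mem_range.1 hi; omega)]
  simp [Finset.sum_add_distrib]
  ring

end FlowerStrategies

/-! ### Strategies towards `z_0`, and mirrored strategies. -/

section FlowerUpperBound

variable {k : ℕ}

/-- A strategy towards `z_0` through the vertices of one kind `c`. -/
noncomputable def hubStrategy (k : ℕ) (c : FlowerKind) (t : FlowerKind) (j : ℤ) : ℝ :=
  if t = c then 4 * flowerPow k j
  else if t = .z then (if j = 0 then 0 else 2)
  else if j.natAbs = k then 1 else 0

theorem isPebblingStrategy_hubStrategy (hk : 1 ≤ k) {c : FlowerKind} (hc : c ≠ .z) :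
    IsPebblingStrategy (flowerSnark k) (flowerCenter k .z) (fun a => hubStrategy k c a.1 a.2) := by
  refine isPebblingStrategy_flower hk (fun t j _ _ => ?_) (fun t j h1 h2 hpos => ?_)
  · have := flowerPow_pos (k := k) j
    unfold hubStrategy
    split_ifs <;> linarith
  have hj : j.natAbs ≤ k := by omega
  by_cases htc : t = c
  · subst htc
    by_cases hj0 : j = 0
    · exact ⟨.z, j, .hub _ _ hc, Or.inl ⟨rfl, hj0⟩⟩
    · obtain ⟨i, hi, hi1, hi2, -, hP⟩ := exists_flowerPow_parent hj0 hj
      refine ⟨t, i, .step _ _ _ hc hi hi1 hi2, Or.inr ?_⟩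
      simp only [hubStrategy, if_true, hP]
      linarith
  · by_cases htz : t = .z
    · subst htz
      have hj0 : j ≠ 0 := by
        rintro rfl
        simp [hubStrategy, htc] at hpos
      refine ⟨c, j, .spoke _ _ hc, Or.inr ?_⟩
      -- The worst case is `|j| = k`, where the vertex of kind `c` has weight `4`, exactly twice
      -- that of `z_j`.
      have := one_le_flowerPow (k := k) j
      simp only [hubStrategy, if_neg htc, if_neg hj0, if_true]
      linarith
    · have hjk : j.natAbs = k := by
        by_contra h
        simp [hubStrategy, htc, htz, h] at hpos
      have hj0 : j ≠ 0 := by omega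
      refine ⟨.z, j, .hub _ _ htz, Or.inr ?_⟩
      simp [hubStrategy, htc, htz, hjk, hj0, hc.symm]

theorem sum_hubStrategy (hk : 1 ≤ k) {c : FlowerKind} (hc : c ≠ .z) :
    ∑ a : FlowerVertex k, hubStrategy k c a.1 a.2 = 12 * 2 ^ k - 4 + 4 * k := by
  obtain ⟨n, rfl⟩ := Nat.exists_eq_add_of_le' hk
  have e1 : ((n : ℤ) + 1).natAbs = n + 1 := by omega
  have e2 : ((n : ℤ) + 1) ≠ 0 := by omega
  have e3 : (-((n : ℤ) + 1)) ≠ 0 := by omega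
  have e4 : (-((n : ℤ) + 1)).natAbs = n + 1 := by omega
  rw [sum_flowerVertex_eq n _ 4 8]
  · cases c
    case z => exact absurd rfl hc
    all_goals
      simp only [hubStrategy, flowerPow_of_natAbs e1, flowerPow_of_natAbs e4, e1, e2, e3, e4,
        flowerPow_zero]
      simp
      ring
  · intro j h1 h2
    have e1 : j.natAbs ≠ n + 1 := by omega
    have e3 : (-j).natAbs ≠ n + 1 := by omega
    cases c
    case z => exact absurd rfl hc
    all_goals
      simp [hubStrategy, flowerPow_neg, e1, h1.ne']
      ring

/-- The constant `6` is `2 + 2 + 2` on each `z_j` with `j ≠ 0` and `4 + 1 + 1` on the other vertices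
at the two ends; elsewhere a single strategy already gives at least `8`. -/
theorem unsolvable_size_le_z (hk : 1 ≤ k) {C : FlowerVertex k → ℕ}
    (hC : ¬ PebblingSolvable (flowerSnark k) (flowerCenter k .z) C) :
    6 * ∑ a, (C a : ℝ) ≤ 36 * 2 ^ k - 12 + 12 * k := by
  have h := IsPebblingStrategy.size_le (G := flowerSnark k) {FlowerKind.v, .x, .y}
    (w := fun c a => hubStrategy k c a.1 a.2) (r := flowerCenter k .z) (c := 6)
    (fun c hc => isPebblingStrategy_hubStrategy hk (by rintro rfl; simp at hc)) ?_ hC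
  · rw [Finset.sum_congr rfl fun c hc => sum_hubStrategy hk (by rintro rfl; simp at hc)] at h
    simp at h
    linarith
  · rintro ⟨t, j, hj⟩ hne
    have hj' := Finset.mem_Icc.1 hj
    have h1 := one_le_flowerPow (k := k) j
    have hsum : ∀ g : FlowerKind → ℝ,
        ∑ i ∈ ({FlowerKind.v, .x, .y} : Finset FlowerKind), g i = g .v + (g .x + g .y) := by
      intro g; simp
    rw [hsum]
    by_cases hjk : j.natAbs = k
    · have hj0 : j ≠ 0 := by omega
      cases t <;> simp [hubStrategy, hjk, hj0] <;> linarith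
    · have h2 := two_le_flowerPow (k := k) (j := j) (by omega)
      cases t
      case z =>
        have hj0 : j ≠ 0 := by
          rintro rfl
          exact hne rfl
        simp [hubStrategy, hj0]
        norm_num
      all_goals
        simp [hubStrategy, hjk]
        linarith

theorem IsPebblingStrategy.reflect (hk : 1 ≤ k) {t₀ : FlowerKind} {f : FlowerKind → ℤ → ℝ}
    (h : IsPebblingStrategy (flowerSnark k) (flowerCenter k t₀) (fun a => f a.1 a.2)) :
    IsPebblingStrategy (flowerSnark k) (flowerCenter k t₀) (fun a => f a.1 (-a.2)) where
  nonneg a := h.nonneg (flowerReflectFun k a)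
  parent a ha := by
    obtain ⟨p, hadj, hp⟩ := h.parent (flowerReflectFun k a) ha
    refine ⟨flowerReflectFun k p, ?_, ?_⟩
    · simpa [flowerReflectFun_flowerReflectFun] using flowerReflectFun_adj hk hadj
    · refine hp.imp ?_ fun hp => ?_
      · rintro rfl
        simp [flowerReflectFun, flowerCenter]
      · simpa [flowerReflectFun] using hp

theorem sum_reflect (hk : 1 ≤ k) (f : FlowerKind → ℤ → ℝ) :
    ∑ a : FlowerVertex k, f a.1 (-a.2) = ∑ a : FlowerVertex k, f a.1 a.2 :=
  (flowerReflect hk).toEquiv.sum_comp fun a => f a.1 a.2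

/-- A strategy, its mirror image and a third strategy together bound unsolvable configurations. -/
theorem unsolvable_size_le_of_strategies (hk : 1 ≤ k) {t₀ : FlowerKind}
    {f g : FlowerKind → ℤ → ℝ} {c : ℝ}
    (hf : IsPebblingStrategy (flowerSnark k) (flowerCenter k t₀) (fun a => f a.1 a.2))
    (hg : IsPebblingStrategy (flowerSnark k) (flowerCenter k t₀) (fun a => g a.1 a.2))
    (hcover : ∀ t j, -(k : ℤ) ≤ j → j ≤ k → (t = t₀ → j ≠ 0) →
      c ≤ f t j + f t (-j) + g t j)
    {C : FlowerVertex k → ℕ}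
    (hC : ¬ PebblingSolvable (flowerSnark k) (flowerCenter k t₀) C) :
    c * ∑ a, (C a : ℝ) ≤
      2 * (∑ a : FlowerVertex k, f a.1 a.2) + ∑ a : FlowerVertex k, g a.1 a.2 := by
  have h := IsPebblingStrategy.size_le (G := flowerSnark k) (Finset.univ : Finset (Fin 3))
    (w := ![fun a => f a.1 a.2, fun a => f a.1 (-a.2), fun a => g a.1 a.2])
    (r := flowerCenter k t₀) (c := c) (fun i _ => ?_) ?_ hC
  · simp only [Fin.sum_univ_three] at h
    simp only [Matrix.cons_val_zero, Matrix.cons_val_one, Matrix.cons_val] at h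
    rw [sum_reflect hk] at h
    linarith
  · fin_cases i
    · exact hf
    · exact hf.reflect hk
    · exact hg
  · rintro ⟨t, j, hj⟩ hne
    have hj' := Finset.mem_Icc.1 hj
    simp only [Fin.sum_univ_three]
    simp only [Matrix.cons_val_zero, Matrix.cons_val_one, Matrix.cons_val]
    refine hcover t j hj'.1 hj'.2 ?_
    rintro rfl rfl
    exact hne rfl

end FlowerUpperBound

/-! ### Strategies towards `v_0` and `x_0`. -/

section FlowerUpperBound

variable {k : ℕ}

theorem two_le_two_pow (hk : 1 ≤ k) : (2 : ℝ) ≤ 2 ^ k := by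
  simpa using pow_le_pow_right₀ (one_le_two (α := ℝ)) hk

/-- A strategy towards `v_0` through `v_1`. -/
noncomputable def rimStrategy (k : ℕ) (t : FlowerKind) (j : ℤ) : ℝ :=
  match t with
  | .v => if 1 ≤ j then 16 * (2 ^ k - 1) * flowerPow k j else 0
  | .z => if j = k then 8 * (2 ^ k - 1) else if j = -k then 2 ^ k - 1
      else if 1 ≤ j then 12 * (2 ^ k - flowerPow k j) else 0
  | _ => if j = k then 4 * (2 ^ k - 1) else if j = -k then 2 * (2 ^ k - 1)
      else if 1 ≤ j then 6 * (2 ^ k - flowerPow k j) else 0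

/-- A strategy towards `v_0` through `z_0`. -/
noncomputable def rimHubStrategy (k : ℕ) (t : FlowerKind) (j : ℤ) : ℝ :=
  match t with
  | .v => 0
  | .z => if j = 0 then 12 * 2 ^ k else if j.natAbs = k then 3 else 0
  | _ => 6 * flowerPow k j

/-- A strategy towards `x_0` through `x_1`. -/
noncomputable def pathStrategy (k : ℕ) (t : FlowerKind) (j : ℤ) : ℝ :=
  match t with
  | .x => if 1 ≤ j then 16 * (2 ^ k - 1) * flowerPow k j else 0
  | .z => if j = k then 8 * (2 ^ k - 1) else if j = -k then 4 * (2 ^ k - 1)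
      else if 1 ≤ j then 12 * (2 ^ k - flowerPow k j) else 0
  | .v => if j = k then 4 * (2 ^ k - 1) else if j = -k then 2 * (2 ^ k - 1)
      else if 1 ≤ j then 6 * (2 ^ k - flowerPow k j) else 0
  | .y => if j = k then 0 else if j = -k then 8 * (2 ^ k - 1)
      else if 1 ≤ j then 6 * (2 ^ k - flowerPow k j) else 0

/-- A strategy towards `x_0` through `z_0`. -/
noncomputable def pathHubStrategy (k : ℕ) (t : FlowerKind) (j : ℤ) : ℝ :=
  match t with
  | .x => 0
  | .z => if j = 0 then 12 * 2 ^ k else 0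
  | .v => 6 * flowerPow k j
  | .y => if j.natAbs = k then 4 else 6 * flowerPow k j

/-- This lets `z_j` hang from the vertex of the root's kind with weight `12 * (2 ^ k - flowerPow k
j)`. It fails at `|j| = k`, which is why the end weights are chosen separately. -/
theorem flowerPow_spoke_le (hk : 1 ≤ k) {j : ℤ} (h : j.natAbs < k) :
    24 * (2 ^ k - flowerPow k j) ≤ 16 * (2 ^ k - 1) * flowerPow k j := by
  have := two_le_flowerPow h
  have := two_le_two_pow hk
  nlinarith

theorem isPebblingStrategy_rimStrategy (hk : 1 ≤ k) :
    IsPebblingStrategy (flowerSnark k) (flowerCenter k .v)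
      (fun a => rimStrategy k a.1 a.2) := by
  have hK := two_le_two_pow hk
  refine isPebblingStrategy_flower hk (fun t j _ _ => ?_) (fun t j h1 h2 hpos => ?_)
  · have := flowerPow_pos (k := k) j
    have := flowerPow_le (k := k) j
    have : 0 ≤ 16 * (2 ^ k - 1) * flowerPow k j := by
      refine mul_nonneg ?_ ?_ <;> linarith
    cases t <;> simp only [rimStrategy] <;> split_ifs <;> linarith
  have hj : j.natAbs ≤ k := by omega
  have hjk : j = k → ¬ j = -k := by omega
  cases t with
  | v =>
    have hj1 : 1 ≤ j := by
      by_contra h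
      simp [rimStrategy, h] at hpos
    by_cases hj2 : j = 1
    · exact ⟨.v, 0, .step _ _ _ (by simp) (by omega) (by omega) (by omega), Or.inl ⟨rfl, rfl⟩⟩
    · refine ⟨.v, j - 1, .step _ _ _ (by simp) (by omega) (by omega) (by omega), Or.inr ?_⟩
      have h3 : 1 ≤ j - 1 := by omega
      simp only [rimStrategy, hj1, h3, if_true,
        flowerPow_step (k := k) (i := j - 1) (j := j) (by omega) hj]
      exact le_of_eq (by ring)
  | z =>
    by_cases e1 : j = k
    · refine ⟨.v, j, .spoke _ _ (by simp), Or.inr ?_⟩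
      have h3 : (1 : ℤ) ≤ j := by omega
      simp only [rimStrategy, h3, if_true, flowerPow_of_natAbs (show j.natAbs = k by omega), if_pos e1]
      linarith
    by_cases e2 : j = -k
    · refine ⟨.x, j, .spoke _ _ (by simp), Or.inr ?_⟩
      simp only [rimStrategy, if_neg e1, if_pos e2]
      linarith
    have hj1 : 1 ≤ j := by
      by_contra h
      simp [rimStrategy, h, e1, e2] at hpos
    refine ⟨.v, j, .spoke _ _ (by simp), Or.inr ?_⟩
    have := flowerPow_spoke_le hk (j := j) (by omega)
    simp only [rimStrategy, if_neg e1, if_neg e2, if_pos hj1]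
    linarith
  | x =>
    by_cases e1 : j = k
    · refine ⟨.z, j, .hub _ _ (by simp), Or.inr ?_⟩
      simp only [rimStrategy, if_pos e1]
      linarith
    by_cases e2 : j = -k
    · refine ⟨.y, -j, .crossXY _ _ (by omega) rfl, Or.inr ?_⟩
      have e3 : -j = k := by omega
      simp only [rimStrategy, if_neg e1, if_pos e2, if_pos e3]
      linarith
    have hj1 : 1 ≤ j := by
      by_contra h
      simp [rimStrategy, h, e1, e2] at hpos
    refine ⟨.z, j, .hub _ _ (by simp), Or.inr ?_⟩
    simp only [rimStrategy, if_neg e1, if_neg e2, if_pos hj1]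
    linarith
  | y =>
    by_cases e1 : j = k
    · refine ⟨.z, j, .hub _ _ (by simp), Or.inr ?_⟩
      simp only [rimStrategy, if_pos e1]
      linarith
    by_cases e2 : j = -k
    · refine ⟨.x, -j, .crossYX _ _ (by omega) rfl, Or.inr ?_⟩
      have e3 : -j = k := by omega
      simp only [rimStrategy, if_neg e1, if_pos e2, if_pos e3]
      linarith
    have hj1 : 1 ≤ j := by
      by_contra h
      simp [rimStrategy, h, e1, e2] at hpos
    refine ⟨.z, j, .hub _ _ (by simp), Or.inr ?_⟩
    simp only [rimStrategy, if_neg e1, if_neg e2, if_pos hj1]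
    linarith

theorem isPebblingStrategy_rimHubStrategy (hk : 1 ≤ k) :
    IsPebblingStrategy (flowerSnark k) (flowerCenter k .v)
      (fun a => rimHubStrategy k a.1 a.2) := by
  have hK := two_le_two_pow hk
  refine isPebblingStrategy_flower hk (fun t j _ _ => ?_) (fun t j h1 h2 hpos => ?_)
  · have := flowerPow_pos (k := k) j
    cases t <;> simp only [rimHubStrategy] <;> (try split_ifs) <;> linarith
  have hj : j.natAbs ≤ k := by omega
  cases t with
  | v => simp [rimHubStrategy] at hpos
  | z =>
    by_cases e1 : j = 0
    · exact ⟨.v, j, .spoke _ _ (by simp), Or.inl ⟨rfl, e1⟩⟩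
    have e2 : j.natAbs = k := by
      by_contra h
      simp [rimHubStrategy, h, e1] at hpos
    refine ⟨.x, j, .spoke _ _ (by simp), Or.inr ?_⟩
    simp only [rimHubStrategy, if_neg e1, if_pos e2, flowerPow_of_natAbs e2]
    norm_num
  | x =>
    by_cases e1 : j = 0
    · refine ⟨.z, j, .hub _ _ (by simp), Or.inr ?_⟩
      simp only [rimHubStrategy, e1, if_true, flowerPow_zero]
      linarith
    obtain ⟨i, hi, hi1, hi2, -, hP⟩ := exists_flowerPow_parent e1 hj
    refine ⟨.x, i, .step _ _ _ (by simp) hi hi1 hi2, Or.inr ?_⟩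
    simp only [rimHubStrategy, hP]
    linarith
  | y =>
    by_cases e1 : j = 0
    · refine ⟨.z, j, .hub _ _ (by simp), Or.inr ?_⟩
      simp only [rimHubStrategy, e1, if_true, flowerPow_zero]
      linarith
    obtain ⟨i, hi, hi1, hi2, -, hP⟩ := exists_flowerPow_parent e1 hj
    refine ⟨.y, i, .step _ _ _ (by simp) hi hi1 hi2, Or.inr ?_⟩
    simp only [rimHubStrategy, hP]
    linarith

theorem isPebblingStrategy_pathStrategy (hk : 1 ≤ k) :
    IsPebblingStrategy (flowerSnark k) (flowerCenter k .x)
      (fun a => pathStrategy k a.1 a.2) := by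
  have hK := two_le_two_pow hk
  refine isPebblingStrategy_flower hk (fun t j _ _ => ?_) (fun t j h1 h2 hpos => ?_)
  · have := flowerPow_pos (k := k) j
    have := flowerPow_le (k := k) j
    have : 0 ≤ 16 * (2 ^ k - 1) * flowerPow k j := by
      refine mul_nonneg ?_ ?_ <;> linarith
    cases t <;> simp only [pathStrategy] <;> split_ifs <;> linarith
  have hj : j.natAbs ≤ k := by omega
  cases t with
  | x =>
    have hj1 : 1 ≤ j := by
      by_contra h
      simp [pathStrategy, h] at hpos
    by_cases hj2 : j = 1
    · exact ⟨.x, 0, .step _ _ _ (by simp) (by omega) (by omega) (by omega), Or.inl ⟨rfl, rfl⟩⟩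
    · refine ⟨.x, j - 1, .step _ _ _ (by simp) (by omega) (by omega) (by omega), Or.inr ?_⟩
      have h3 : 1 ≤ j - 1 := by omega
      simp only [pathStrategy, hj1, h3, if_true,
        flowerPow_step (k := k) (i := j - 1) (j := j) (by omega) hj]
      exact le_of_eq (by ring)
  | z =>
    by_cases e1 : j = k
    · refine ⟨.x, j, .spoke _ _ (by simp), Or.inr ?_⟩
      have h3 : (1 : ℤ) ≤ j := by omega
      simp only [pathStrategy, h3, if_true, flowerPow_of_natAbs (show j.natAbs = k by omega), if_pos e1]
      linarith
    by_cases e2 : j = -k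
    · refine ⟨.y, j, .spoke _ _ (by simp), Or.inr ?_⟩
      simp only [pathStrategy, if_neg e1, if_pos e2]
      linarith
    have hj1 : 1 ≤ j := by
      by_contra h
      simp [pathStrategy, h, e1, e2] at hpos
    refine ⟨.x, j, .spoke _ _ (by simp), Or.inr ?_⟩
    have := flowerPow_spoke_le hk (j := j) (by omega)
    simp only [pathStrategy, if_neg e1, if_neg e2, if_pos hj1]
    linarith
  | v =>
    refine ⟨.z, j, .hub _ _ (by simp), Or.inr ?_⟩
    simp only [pathStrategy]
    split_ifs <;> linarith
  | y =>
    by_cases e1 : j = k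
    · simp [pathStrategy, e1] at hpos
    by_cases e2 : j = -k
    · refine ⟨.x, -j, .crossYX _ _ (by omega) rfl, Or.inr ?_⟩
      have e3 : 1 ≤ -j := by omega
      simp only [pathStrategy, if_neg e1, if_pos e2, if_pos e3,
        flowerPow_of_natAbs (show (-j).natAbs = k by omega)]
      linarith
    refine ⟨.z, j, .hub _ _ (by simp), Or.inr ?_⟩
    simp only [pathStrategy, if_neg e1, if_neg e2]
    split_ifs <;> linarith

theorem isPebblingStrategy_pathHubStrategy (hk : 1 ≤ k) :
    IsPebblingStrategy (flowerSnark k) (flowerCenter k .x)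
      (fun a => pathHubStrategy k a.1 a.2) := by
  have hK := two_le_two_pow hk
  refine isPebblingStrategy_flower hk (fun t j _ _ => ?_) (fun t j h1 h2 hpos => ?_)
  · have := flowerPow_pos (k := k) j
    cases t <;> simp only [pathHubStrategy] <;> (try split_ifs) <;> linarith
  have hj : j.natAbs ≤ k := by omega
  cases t with
  | x => simp [pathHubStrategy] at hpos
  | z =>
    have e1 : j = 0 := by
      by_contra h
      simp [pathHubStrategy, h] at hpos
    exact ⟨.x, j, .spoke _ _ (by simp), Or.inl ⟨rfl, e1⟩⟩
  | v =>
    by_cases e1 : j = 0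
    · refine ⟨.z, j, .hub _ _ (by simp), Or.inr ?_⟩
      simp only [pathHubStrategy, e1, if_true, flowerPow_zero]
      linarith
    obtain ⟨i, hi, hi1, hi2, -, hP⟩ := exists_flowerPow_parent e1 hj
    refine ⟨.v, i, .step _ _ _ (by simp) hi hi1 hi2, Or.inr ?_⟩
    simp only [pathHubStrategy, hP]
    linarith
  | y =>
    by_cases e1 : j = 0
    · refine ⟨.z, j, .hub _ _ (by simp), Or.inr ?_⟩
      have e2 : (0 : ℤ).natAbs ≠ k := by simp; omega
      simp only [pathHubStrategy, e1, if_true, if_neg e2, flowerPow_zero]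
      simp
      linarith
    obtain ⟨i, hi, hi1, hi2, hik, hP⟩ := exists_flowerPow_parent e1 hj
    refine ⟨.y, i, .step _ _ _ (by simp) hi hi1 hi2, Or.inr ?_⟩
    have := one_le_flowerPow (k := k) j
    simp only [pathHubStrategy, if_neg hik.ne, hP]
    split_ifs <;> linarith

end FlowerUpperBound

/-! ### Covering, total weights and the common upper bound. -/

section FlowerUpperBound

variable {k : ℕ}

/-- On the `x` and `y` vertices the weights are tuned to equality: `6 * (2 ^ k - P) + 6 * P` with `P
= flowerPow k j` inside, and `(4 + 2) * (2 ^ k - 1) + 6` at the ends. On the `v` and `z` vertices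
there is slack. -/
theorem rim_cover (hk : 1 ≤ k) (t : FlowerKind) (j : ℤ) (h1 : -(k : ℤ) ≤ j) (h2 : j ≤ k)
    (h : t = .v → j ≠ 0) :
    6 * 2 ^ k ≤ rimStrategy k t j + rimStrategy k t (-j) + rimHubStrategy k t j := by
  have hK := two_le_two_pow hk
  have hP := one_le_flowerPow (k := k) j
  have hv : 6 * 2 ^ k ≤ 16 * (2 ^ k - 1) * flowerPow k j := by nlinarith
  by_cases e0 : j = 0
  · have e1 : (0 : ℤ) ≠ k := by omega
    have e3 : k ≠ 0 := by omega
    subst e0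
    cases t with
    | v => exact absurd rfl (h rfl)
    | z => simp [rimStrategy, rimHubStrategy, e1, e3]; linarith
    | _ => simp [rimStrategy, rimHubStrategy, e1, e3, flowerPow_zero]
  by_cases ek : j.natAbs = k
  · have hP1 := flowerPow_of_natAbs ek
    rw [hP1] at hv
    cases t <;> simp only [rimStrategy, rimHubStrategy, flowerPow_neg, hP1] <;> split_ifs <;>
      first | (exfalso; omega) | linarith
  · have hP2 := two_mul_flowerPow_le e0 (by omega : j.natAbs ≤ k)
    cases t <;> simp only [rimStrategy, rimHubStrategy, flowerPow_neg] <;> split_ifs <;>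
      first | (exfalso; omega) | linarith

/-- As for the rim, except that at the ends `y` gets `8 * (2 ^ k - 1)` from the direction that
reaches it across the crossing, nothing from the other, and `4` through `z_0`. -/
theorem path_cover (hk : 1 ≤ k) (t : FlowerKind) (j : ℤ) (h1 : -(k : ℤ) ≤ j) (h2 : j ≤ k)
    (h : t = .x → j ≠ 0) :
    6 * 2 ^ k ≤ pathStrategy k t j + pathStrategy k t (-j) + pathHubStrategy k t j := by
  have hK := two_le_two_pow hk
  have hP := one_le_flowerPow (k := k) j
  have hv : 6 * 2 ^ k ≤ 16 * (2 ^ k - 1) * flowerPow k j := by nlinarith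
  by_cases e0 : j = 0
  · have e1 : (0 : ℤ) ≠ k := by omega
    have e2 : (0 : ℕ) ≠ k := by omega
    have e3 : k ≠ 0 := by omega
    subst e0
    cases t with
    | x => exact absurd rfl (h rfl)
    | z => simp [pathStrategy, pathHubStrategy, e1, e3]; linarith
    | _ => simp [pathStrategy, pathHubStrategy, e1, e2, e3, flowerPow_zero]
  by_cases ek : j.natAbs = k
  · have hP1 := flowerPow_of_natAbs ek
    rw [hP1] at hv
    cases t <;> simp only [pathStrategy, pathHubStrategy, flowerPow_neg, hP1] <;> split_ifs <;>
      first | (exfalso; omega) | linarith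
  · have hP2 := two_mul_flowerPow_le e0 (by omega : j.natAbs ≤ k)
    cases t <;> simp only [pathStrategy, pathHubStrategy, flowerPow_neg] <;> split_ifs <;>
      first | (exfalso; omega) | linarith

theorem sum_rimStrategy (n : ℕ) :
    ∑ a : FlowerVertex (n + 1), rimStrategy (n + 1) a.1 a.2 =
      16 * (2 ^ (n + 1) - 1) ^ 2 + 21 * (2 ^ (n + 1) - 1) +
        24 * (n * 2 ^ (n + 1) - 2 ^ (n + 1) + 2) := by
  rw [sum_flowerVertex_eq n _ (24 * 2 ^ (n + 1)) (16 * (2 ^ (n + 1) - 1) - 24)]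
  · have e1 : (0 : ℤ) ≠ (n : ℤ) + 1 := by omega
    have e2 : (0 : ℤ) ≠ -((n : ℤ) + 1) := by omega
    have e3 : -((n : ℤ) + 1) ≠ n + 1 := by omega
    have e4 : (1 : ℤ) ≤ n + 1 := by omega
    have e5 : ¬ (1 : ℤ) ≤ -(n + 1) := by omega
    simp only [rimStrategy, Nat.cast_add, Nat.cast_one, if_neg e1, if_neg e2, if_neg e3, if_pos e4,
      if_neg e5, if_true, flowerPow_of_natAbs (show ((n : ℤ) + 1).natAbs = n + 1 by omega)]
    norm_num
    ring
  · intro j h1 h2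
    have e1 : j ≠ (n : ℤ) + 1 := by omega
    have e2 : j ≠ -((n : ℤ) + 1) := by omega
    have e3 : -j ≠ (n : ℤ) + 1 := by omega
    have e4 : -j ≠ -((n : ℤ) + 1) := by omega
    have e5 : (1 : ℤ) ≤ j := by omega
    have e6 : ¬ (1 : ℤ) ≤ -j := by omega
    simp only [rimStrategy, Nat.cast_add, Nat.cast_one, if_neg e1, if_neg e2, if_neg e3, if_neg e4,
      if_pos e5, if_neg e6]
    ring

theorem sum_pathStrategy (n : ℕ) :
    ∑ a : FlowerVertex (n + 1), pathStrategy (n + 1) a.1 a.2 =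
      16 * (2 ^ (n + 1) - 1) ^ 2 + 26 * (2 ^ (n + 1) - 1) +
        24 * (n * 2 ^ (n + 1) - 2 ^ (n + 1) + 2) := by
  rw [sum_flowerVertex_eq n _ (24 * 2 ^ (n + 1)) (16 * (2 ^ (n + 1) - 1) - 24)]
  · have e1 : (0 : ℤ) ≠ (n : ℤ) + 1 := by omega
    have e2 : (0 : ℤ) ≠ -((n : ℤ) + 1) := by omega
    have e3 : -((n : ℤ) + 1) ≠ n + 1 := by omega
    have e4 : (1 : ℤ) ≤ n + 1 := by omega
    have e5 : ¬ (1 : ℤ) ≤ -(n + 1) := by omega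
    simp only [pathStrategy, Nat.cast_add, Nat.cast_one, if_neg e1, if_neg e2, if_neg e3,
      if_pos e4, if_neg e5, if_true,
      flowerPow_of_natAbs (show ((n : ℤ) + 1).natAbs = n + 1 by omega)]
    norm_num
    ring
  · intro j h1 h2
    have e1 : j ≠ (n : ℤ) + 1 := by omega
    have e2 : j ≠ -((n : ℤ) + 1) := by omega
    have e3 : -j ≠ (n : ℤ) + 1 := by omega
    have e4 : -j ≠ -((n : ℤ) + 1) := by omega
    have e5 : (1 : ℤ) ≤ j := by omega
    have e6 : ¬ (1 : ℤ) ≤ -j := by omega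
    simp only [pathStrategy, Nat.cast_add, Nat.cast_one, if_neg e1, if_neg e2, if_neg e3,
      if_neg e4, if_pos e5, if_neg e6]
    ring

theorem sum_rimHubStrategy (n : ℕ) :
    ∑ a : FlowerVertex (n + 1), rimHubStrategy (n + 1) a.1 a.2 = 48 * 2 ^ (n + 1) - 18 := by
  rw [sum_flowerVertex_eq n _ 0 24]
  · have e1 : ((n : ℤ) + 1).natAbs = n + 1 := by omega
    have e2 : (-((n : ℤ) + 1)).natAbs = n + 1 := by omega
    have e3 : (n : ℤ) + 1 ≠ 0 := by omega
    have e4 : -((n : ℤ) + 1) ≠ 0 := by omega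
    simp only [rimHubStrategy, e1, e2, if_neg e3, if_neg e4, if_true, flowerPow_zero,
      flowerPow_of_natAbs e1, flowerPow_of_natAbs e2]
    ring
  · intro j h1 h2
    have e1 : j.natAbs ≠ n + 1 := by omega
    have e2 : (-j).natAbs ≠ n + 1 := by omega
    have e3 : j ≠ 0 := by omega
    have e4 : -j ≠ 0 := by omega
    simp only [rimHubStrategy, if_neg e1, if_neg e2, if_neg e3, if_neg e4, flowerPow_neg]
    ring

theorem sum_pathHubStrategy (n : ℕ) :
    ∑ a : FlowerVertex (n + 1), pathHubStrategy (n + 1) a.1 a.2 = 48 * 2 ^ (n + 1) - 28 := by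
  rw [sum_flowerVertex_eq n _ 0 24]
  · have e1 : ((n : ℤ) + 1).natAbs = n + 1 := by omega
    have e2 : (-((n : ℤ) + 1)).natAbs = n + 1 := by omega
    have e3 : (n : ℤ) + 1 ≠ 0 := by omega
    have e4 : -((n : ℤ) + 1) ≠ 0 := by omega
    have e5 : (0 : ℤ).natAbs ≠ n + 1 := by simp
    simp only [pathHubStrategy, e1, e2, if_neg e3, if_neg e4, if_neg e5, if_true, flowerPow_zero,
      flowerPow_of_natAbs e1, flowerPow_of_natAbs e2]
    ring
  · intro j h1 h2
    have e1 : j.natAbs ≠ n + 1 := by omega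
    have e2 : (-j).natAbs ≠ n + 1 := by omega
    have e3 : j ≠ 0 := by omega
    have e4 : -j ≠ 0 := by omega
    simp only [pathHubStrategy, if_neg e1, if_neg e2, if_neg e3, if_neg e4, flowerPow_neg]
    ring

theorem unsolvable_size_le_v (hk : 1 ≤ k) {C : FlowerVertex k → ℕ}
    (hC : ¬ PebblingSolvable (flowerSnark k) (flowerCenter k .v) C) :
    6 * 2 ^ k * ∑ a, (C a : ℝ) ≤ 32 * (2 ^ k) ^ 2 + 48 * k * 2 ^ k - 70 * 2 ^ k + 68 := by
  have h := unsolvable_size_le_of_strategies hk (isPebblingStrategy_rimStrategy hk)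
    (isPebblingStrategy_rimHubStrategy hk) (rim_cover hk) hC
  obtain ⟨n, rfl⟩ := Nat.exists_eq_add_of_le' hk
  rw [sum_rimStrategy, sum_rimHubStrategy] at h
  push_cast
  linarith

theorem unsolvable_size_le_x (hk : 1 ≤ k) {C : FlowerVertex k → ℕ}
    (hC : ¬ PebblingSolvable (flowerSnark k) (flowerCenter k .x) C) :
    6 * 2 ^ k * ∑ a, (C a : ℝ) ≤ 32 * (2 ^ k) ^ 2 + 48 * k * 2 ^ k - 60 * 2 ^ k + 48 := by
  have h := unsolvable_size_le_of_strategies hk (isPebblingStrategy_pathStrategy hk)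
    (isPebblingStrategy_pathHubStrategy hk) (path_cover hk) hC
  obtain ⟨n, rfl⟩ := Nat.exists_eq_add_of_le' hk
  rw [sum_pathStrategy, sum_pathHubStrategy] at h
  push_cast
  linarith

/-- The bounds for `v_0` and `x_0` are about `(16 / 3) * 2 ^ k + 8 * k`; this absorbs the surplus `6
* k` into the larger coefficient `36 / 5` of `2 ^ k`. -/
theorem four_mul_le_two_pow (hk : 4 ≤ k) : 4 * (k : ℝ) ≤ 2 ^ k := by
  induction k, hk using Nat.le_induction with
  | base => norm_num
  | succ n hn ih =>
    have : (4 : ℝ) ≤ n := by exact_mod_cast hn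
    rw [pow_succ]
    push_cast
    linarith

/-- The common bound for the sizes of unsolvable configurations. -/
theorem unsolvable_size_le_center (hk : 1 ≤ k) {t : FlowerKind} (ht : t ≠ .y)
    {C : FlowerVertex k → ℕ} (hC : ¬ PebblingSolvable (flowerSnark k) (flowerCenter k t) C) :
    ((∑ a, C a : ℕ) : ℝ) ≤ (9 / 5) * 2 ^ (k + 2) + 2 * k - 18 / 5 := by
  have hK := two_le_two_pow hk
  have hbound : ∀ {N : ℕ}, 6 * 2 ^ k * (N : ℝ) ≤
      32 * (2 ^ k) ^ 2 + 48 * k * 2 ^ k - 60 * 2 ^ k + 48 →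
      (N : ℝ) ≤ (9 / 5) * 2 ^ (k + 2) + 2 * k - 18 / 5 := by
    intro N h
    rcases (by omega : k = 1 ∨ k = 2 ∨ k = 3 ∨ 4 ≤ k) with rfl | rfl | rfl | h4
    · norm_num at h ⊢
      linarith
    · norm_num at h ⊢
      -- For `k = 2` the strategies give only `29 + 1 / 3`, above the target `29.2`, so integrality
      -- of the size is needed.
      have : N < 30 := by
        have : (N : ℝ) < 30 := by linarith
        exact_mod_cast this
      have : (N : ℝ) ≤ 29 := by exact_mod_cast Nat.lt_succ_iff.1 this
      linarith
    · norm_num at h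
      have : (N : ℝ) ≤ 60 := by linarith
      norm_num
      exact_mod_cast this
    · have h5 := four_mul_le_two_pow h4
      have h6 : (4 : ℝ) ≤ k := by exact_mod_cast h4
      rw [pow_add]
      refine le_of_mul_le_mul_left (h.trans ?_) (by positivity : (0 : ℝ) < 6 * 2 ^ k)
      nlinarith
  cases t with
  | y => exact absurd rfl ht
  | v =>
    refine hbound ?_
    have := unsolvable_size_le_v hk hC
    push_cast
    linarith
  | x =>
    refine hbound ?_
    have := unsolvable_size_le_x hk hC
    push_cast
    linarith
  | z =>
    have := unsolvable_size_le_z hk hC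
    rw [pow_add]
    push_cast
    linarith

theorem pebblingNumber_flowerSnark_le (hk : 1 ≤ k) :
    pebblingNumber (flowerSnark k) ≤
      ((⌊(9 / 5 : ℝ) * 2 ^ (k + 2) + 2 * (k : ℝ) - 18 / 5⌋₊ + 1 : ℕ) : ℕ∞) := by
  set t := ⌊(9 / 5 : ℝ) * 2 ^ (k + 2) + 2 * (k : ℝ) - 18 / 5⌋₊ + 1 with ht
  have hcenter : ∀ t₀ : FlowerKind, t₀ ≠ .y → ∀ C : FlowerVertex k → ℕ, ∑ v, C v = t →
      PebblingSolvable (flowerSnark k) (flowerCenter k t₀) C := by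
    intro t₀ h₀ C hC
    by_contra hns
    have := Nat.le_floor (unsolvable_size_le_center hk h₀ hns)
    omega
  refine pebblingNumber_le fun r => ?_
  have htrans : ∀ (e : flowerSnark k ≃g flowerSnark k) (a : FlowerVertex k),
      (∀ C : FlowerVertex k → ℕ, ∑ v, C v = t → PebblingSolvable (flowerSnark k) a C) →
      ∀ C : FlowerVertex k → ℕ, ∑ v, C v = t → PebblingSolvable (flowerSnark k) (e a) C :=
    fun e a h C hC => (h (C ∘ e) ((e.toEquiv.sum_comp C).trans hC)).comp_iso e
  refine flowerVertex_induction (fun a => ⟨fun h => ?_, htrans (flowerRotate hk) a⟩)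
    (hcenter _ (by simp)) (hcenter _ (by simp)) (hcenter _ (by simp)) r
  have := htrans (flowerRotate hk).symm _ h
  rwa [show (flowerRotate hk).symm (flowerRotateFun k a) = a from
    flowerUnrotateFun_flowerRotateFun a] at this

end FlowerUpperBound

/-! ### Exponent potentials and the general lower bound. -/

section FlowerLowerBound

variable {k : ℕ}

/-- The exponents `e` grow by at most one along each edge of the Flower snark, and do not grow when
leaving a vertex marked by `u`. -/
structure IsFlowerExponent (k : ℕ) (e : FlowerKind → ℤ → ℕ) (u : FlowerKind → ℤ → Bool) :
    Prop where
  hub : ∀ t : FlowerKind, t ≠ .z → ∀ j ∈ Finset.Icc (-(k : ℤ)) k,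
    e .z j ≤ e t j + (if u t j then 0 else 1) ∧ e t j ≤ e .z j + (if u .z j then 0 else 1)
  step : ∀ t : FlowerKind, t ≠ .z → ∀ j ∈ Finset.Ico (-(k : ℤ)) k,
    e t (j + 1) ≤ e t j + (if u t j then 0 else 1) ∧
      e t j ≤ e t (j + 1) + (if u t (j + 1) then 0 else 1)
  close : ∀ t : FlowerKind, t ≠ .z →
    e t.swap (-k) ≤ e t k + (if u t k then 0 else 1) ∧
      e t k ≤ e t.swap (-k) + (if u t.swap (-k) then 0 else 1)

theorem IsFlowerExponent.of_arc {e : FlowerKind → ℤ → ℕ} {u : FlowerKind → ℤ → Bool}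
    (h : IsFlowerExponent k e u) {a b : FlowerVertex k} (hab : flowerArc k a b) :
    e b.1 b.2 ≤ e a.1 a.2 + (if u a.1 a.2 then 0 else 1) ∧
      e a.1 a.2 ≤ e b.1 b.2 + (if u b.1 b.2 then 0 else 1) := by
  obtain ⟨t, i, hi⟩ := a
  obtain ⟨t', j, hj⟩ := b
  have hi' := Finset.mem_Icc.1 hi
  have hj' := Finset.mem_Icc.1 hj
  have hhub : ∀ s : FlowerKind, s ≠ .z → i = j →
      e s j ≤ e .z i + (if u .z i then 0 else 1) ∧
        e .z i ≤ e s j + (if u s j then 0 else 1) := by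
    rintro s hs rfl
    exact (h.hub s hs i hi).symm
  have hstep : ∀ s : FlowerKind, s ≠ .z → j = i + 1 →
      e s j ≤ e s i + (if u s i then 0 else 1) ∧ e s i ≤ e s j + (if u s j then 0 else 1) := by
    rintro s hs rfl
    exact h.step s hs i (Finset.mem_Ico.2 (by omega))
  have hclose : ∀ s : FlowerKind, s ≠ .z → i = k ∧ j = -k →
      e s.swap j ≤ e s i + (if u s i then 0 else 1) ∧
        e s i ≤ e s.swap j + (if u s.swap j then 0 else 1) := by
    rintro s hs ⟨rfl, rfl⟩
    exact h.close s hs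
  cases t <;> cases t' <;> simp only [flowerArc, Subtype.mk.injEq] at hab <;> dsimp only
  · exact hab.elim (hstep .v (by simp)) (hclose .v (by simp))
  · exact hstep .x (by simp) hab
  · exact hclose .x (by simp) hab
  · exact hclose .y (by simp) hab
  · exact hstep .y (by simp) hab
  · exact hhub .v (by simp) hab
  · exact hhub .x (by simp) hab
  · exact hhub .y (by simp) hab

/-- The value of a configuration under the weights `2 ^ e`, where the first pebble of each vertex
marked by `u` is not counted. -/
noncomputable def flowerValue (k : ℕ) (e : FlowerKind → ℤ → ℕ) (u : FlowerKind → ℤ → Bool)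
    (C : FlowerVertex k → ℕ) : ℕ :=
  pebblingValue (fun a => 2 ^ e a.1 a.2) (Finset.univ.filter fun a => u a.1 a.2) C

theorem IsFlowerExponent.value_le (hk : 1 ≤ k) {e : FlowerKind → ℤ → ℕ}
    {u : FlowerKind → ℤ → Bool} (h : IsFlowerExponent k e u) {C N : FlowerVertex k → ℕ}
    (hN : PebblingCovers (flowerSnark k) C N) : flowerValue k e u N ≤ flowerValue k e u C := by
  refine IsPebblingPotential.value_le (fun a b hab => ?_) hN
  have : e b.1 b.2 ≤ e a.1 a.2 + (if u a.1 a.2 then 0 else 1) := by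
    rcases (flowerSnark_adj_iff hk).1 hab with hab | hab
    · exact (h.of_arc hab).1
    · exact (h.of_arc hab).2
  by_cases hu : u a.1 a.2 = true
  · simp only [Finset.mem_filter, Finset.mem_univ, true_and, hu, if_true, add_zero] at this ⊢
    exact pow_le_pow_right₀ one_le_two this
  · simp only [Finset.mem_filter, Finset.mem_univ, true_and, hu] at this ⊢
    rw [← pow_succ']
    exact pow_le_pow_right₀ one_le_two this

/-- An unsolvable configuration for the root `z_0`: a large stack on `z_k`, and single pebbles on
`v_{-k}`, `x_{-k}`, `y_{-k}` and on the remaining `z_i`. -/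
def stackConfig (k : ℕ) (t : FlowerKind) (j : ℤ) : ℕ :=
  if t = .z then (if j = k then 2 ^ (k + 2) - 1 else if j = 0 then 0 else 1)
  else if j = -k then 1 else 0

/-- The vertices with a single pebble in `stackConfig`. -/
def stackMark (k : ℕ) (t : FlowerKind) (j : ℤ) : Bool :=
  if t = .z then j ≠ k ∧ j ≠ 0 else j = -k

/-- The exponents that show that `stackConfig` is unsolvable. -/
def stackExponent (k : ℕ) (t : FlowerKind) (j : ℤ) : ℕ :=
  if t = .z then (if j = k then 0 else if j = -k then 2 else k + 2 - j.natAbs)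
  else if j = -k then 2 else k + 1 - j.natAbs

/-- The exponent of the root is its distance `k + 2` from the stack on `z_k`. The way round through
index `-k` is one edge longer, but the single pebble there makes one step free. Passing through a
marked `z_i` gains nothing, as its exponent exceeds those of its neighbours by one, or equals them
at `i = -k`. -/
theorem isFlowerExponent_stack (hk : 2 ≤ k) :
    IsFlowerExponent k (stackExponent k) (stackMark k) where
  hub t ht j hj := by
    have hj := Finset.mem_Icc.1 hj
    simp only [stackExponent, stackMark, if_neg ht, if_true, decide_eq_true_eq]
    split_ifs <;> omega
  step t ht j hj := by
    have hj := Finset.mem_Ico.1 hj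
    simp only [stackExponent, stackMark, if_neg ht, decide_eq_true_eq]
    split_ifs <;> omega
  close t ht := by
    have ht' : t.swap ≠ .z := by cases t <;> simp_all [FlowerKind.swap]
    simp only [stackExponent, stackMark, if_neg ht, if_neg ht', decide_eq_true_eq]
    split_ifs <;> omega

theorem not_solvable_stackConfig (hk : 2 ≤ k) :
    ¬ PebblingSolvable (flowerSnark k) (flowerCenter k .z) (fun a => stackConfig k a.1 a.2) := by
  intro h
  have hle := (isFlowerExponent_stack hk).value_le (by omega) h.covers
  have hC : flowerValue k (stackExponent k) (stackMark k) (fun a => stackConfig k a.1 a.2) =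
      2 ^ (k + 2) - 1 := by
    unfold flowerValue pebblingValue
    -- All single pebbles lie on marked vertices, so only the stack of weight-one pebbles is
    -- counted.
    rw [Finset.sum_eq_single (.z, ⟨(k : ℤ), Finset.mem_Icc.2 (by omega)⟩)]
    · simp [stackExponent, stackMark, stackConfig]
    · rintro ⟨t, j, hj⟩ - hne
      have hne' : t = .z → j ≠ k := by
        rintro rfl rfl
        exact hne rfl
      by_cases ht : t = .z
      · subst ht
        by_cases hj0 : j = 0 <;> simp [stackMark, stackConfig, hne' rfl, hj0]
        omega
      · by_cases hjk : j = -k <;> simp [stackMark, stackConfig, ht, hjk]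
    · simp
  have hN : 2 ^ (k + 2) ≤ flowerValue k (stackExponent k) (stackMark k)
      (Pi.single (flowerCenter k .z) 1) := by
    unfold flowerValue pebblingValue
    refine le_trans ?_ (Finset.single_le_sum (fun _ _ => Nat.zero_le _)
      (Finset.mem_univ (flowerCenter k .z)))
    have e1 : (0 : ℤ) ≠ k := by omega
    have e2 : k ≠ 0 := by omega
    simp [flowerCenter, stackExponent, stackMark, e1, e2]
  have : 0 < 2 ^ (k + 2) := by positivity
  omega

theorem sum_stackConfig (hk : 1 ≤ k) :
    ∑ a : FlowerVertex k, stackConfig k a.1 a.2 = 2 ^ (k + 2) + 2 * k + 1 := by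
  -- On the `z` vertices the configuration is constantly one, minus the root and plus the excess of
  -- the stack; the root term is moved to the left to avoid truncated subtraction.
  have hz : ∀ j : ℤ, stackConfig k .z j + (if j = 0 then 1 else 0) =
      1 + if j = k then 2 ^ (k + 2) - 2 else 0 := by
    intro j
    have : 2 ≤ 2 ^ (k + 2) := by
      rw [pow_succ]
      have : 0 < 2 ^ (k + 1) := by positivity
      omega
    simp only [stackConfig, if_true]
    split_ifs <;> omega
  have hzsum := Finset.sum_congr (rfl : Finset.Icc (-(k : ℤ)) k = _) fun j _ => hz j
  have m1 : (0 : ℤ) ∈ Finset.Icc (-(k : ℤ)) k := Finset.mem_Icc.2 (by omega)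
  have m2 : (k : ℤ) ∈ Finset.Icc (-(k : ℤ)) k := Finset.mem_Icc.2 (by omega)
  have m3 : (-k : ℤ) ∈ Finset.Icc (-(k : ℤ)) k := Finset.mem_Icc.2 (by omega)
  have hcard : (Finset.Icc (-(k : ℤ)) k).card = 2 * k + 1 := by
    rw [Int.card_Icc]
    omega
  simp only [Finset.sum_add_distrib, Finset.sum_ite_eq', m1, m2, if_true, Finset.sum_const, hcard,
    smul_eq_mul] at hzsum
  have hother : ∀ t : FlowerKind, t ≠ .z →
      ∑ j ∈ Finset.Icc (-(k : ℤ)) k, stackConfig k t j = 1 := by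
    intro t ht
    simp only [stackConfig, if_neg ht, Finset.sum_ite_eq', m3, if_true]
  rw [sum_flowerVertex]
  simp only [Finset.sum_add_distrib]
  rw [hother .v (by simp), hother .x (by simp), hother .y (by simp)]
  have : 2 ≤ 2 ^ (k + 2) := by
    rw [pow_succ]
    have : 0 < 2 ^ (k + 1) := by positivity
    omega
  omega

theorem le_pebblingNumber_flowerSnark (hk : 2 ≤ k) :
    ((2 ^ (k + 2) + 2 * k + 2 : ℕ) : ℕ∞) ≤ pebblingNumber (flowerSnark k) :=
  le_pebblingNumber (not_solvable_stackConfig hk) (by rw [sum_stackConfig (by omega)])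

end FlowerLowerBound

/-! ### Special configurations for `J_5` and `J_7`. -/

section FlowerLowerBound

/-- The unsolvable configuration of size `22` of `J_5`, for the root `v_0`. -/
def configFive (a : FlowerVertex 2) : ℕ :=
  if (a.1, (a.2 : ℤ)) = (.x, 2) then 15
  else if (a.1, (a.2 : ℤ)) ∈
    [(FlowerKind.x, -2), (.x, -1), (.y, -1), (.y, 1), (.y, 2), (.z, -2), (.z, -1)] then 1
  else 0

/-- The unsolvable configuration of size `40` of `J_7`, for the root `z_0`. -/
def configSeven (a : FlowerVertex 3) : ℕ :=
  if (a.1, (a.2 : ℤ)) = (.z, 3) then 31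
  else if (a.1, (a.2 : ℤ)) ∈
    [(FlowerKind.v, -3), (.x, -3), (.y, -3), (.y, -2), (.z, -3), (.z, -2), (.z, -1), (.z, 1),
      (.z, 2)] then 1
  else 0

/-- The function on the vertices whose values are listed from `-k` to `k` for each kind. -/
def flowerTable (k : ℕ) (v x y z : List ℕ) (t : FlowerKind) (j : ℤ) : ℕ :=
  (match t with
    | .v => v
    | .x => x
    | .y => y
    | .z => z).getD (j + k).toNat 0

/-- Membership in a list of vertices. -/
def flowerMark (l : List (FlowerKind × ℤ)) (t : FlowerKind) (j : ℤ) : Bool := (t, j) ∈ l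

noncomputable instance (k : ℕ) (e : FlowerKind → ℤ → ℕ) (u : FlowerKind → ℤ → Bool) :
    Decidable (IsFlowerExponent k e u) :=
  decidable_of_iff
    ((∀ t : FlowerKind, t ≠ .z → ∀ j ∈ Finset.Icc (-(k : ℤ)) k,
      e .z j ≤ e t j + (if u t j then 0 else 1) ∧ e t j ≤ e .z j + (if u .z j then 0 else 1)) ∧
    (∀ t : FlowerKind, t ≠ .z → ∀ j ∈ Finset.Ico (-(k : ℤ)) k,
      e t (j + 1) ≤ e t j + (if u t j then 0 else 1) ∧
        e t j ≤ e t (j + 1) + (if u t (j + 1) then 0 else 1)) ∧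
    (∀ t : FlowerKind, t ≠ .z →
      e t.swap (-k) ≤ e t k + (if u t k then 0 else 1) ∧
        e t k ≤ e t.swap (-k) + (if u t.swap (-k) then 0 else 1)))
    ⟨fun h => ⟨h.1, h.2.1, h.2.2⟩, fun h => ⟨h.hub, h.step, h.close⟩⟩

/-- For a demand of four pebbles on `z_{-1}`, worth `32`. Unmarking `x_{-1}`, `y_{-1}` and `z_{-1}`
raises the value of `configFive` to `15 + 4 + 4 + 8 = 31`. -/
theorem isFlowerExponent_five_hub : IsFlowerExponent 2
    (flowerTable 2 [2, 3, 4, 3, 2] [2, 2, 2, 1, 0] [1, 2, 2, 2, 2] [2, 3, 3, 2, 1])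
    (flowerMark [(.x, -2), (.y, 1), (.y, 2), (.z, -2)]) := by decide +kernel

/-- For demands of two pebbles on `v_{-2}` together with one on `v_{-1}` or two on `z_{-1}`, both
worth `24`. With `z_{-2}` and `z_{-1}` unmarked, `configFive` is worth `15 + 4 + 4 = 23`. -/
theorem isFlowerExponent_five_rim : IsFlowerExponent 2
    (flowerTable 2 [3, 3, 4, 3, 2] [2, 2, 2, 1, 0] [1, 2, 2, 2, 2] [2, 2, 3, 2, 1])
    (flowerMark [(.x, -2), (.x, -1), (.y, -1), (.y, 1), (.y, 2)]) := by decide +kernel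

theorem isFlowerExponent_five : IsFlowerExponent 2
    (flowerTable 2 [2, 2, 3, 3, 2] [2, 2, 2, 1, 0] [1, 2, 2, 2, 2] [2, 2, 3, 2, 1])
    (flowerMark [(.x, -2), (.x, -1), (.y, -1), (.y, 1), (.y, 2), (.z, -2), (.z, -1)]) := by
  decide +kernel

/-- For demands of two pebbles on `y_{-1}` together with one on `y_0` or two on `y_1`, both worth
`48`. With `y_{-3}`, `y_{-2}` and `z_{-3}` unmarked, `configSeven` is worth `31 + 4 + 8 + 4 = 47`.
-/
theorem isFlowerExponent_seven_path : IsFlowerExponent 3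
    (flowerTable 3 [2, 2, 3, 4, 3, 2, 1] [2, 2, 3, 4, 3, 2, 1] [2, 3, 4, 4, 3, 2, 1]
      [2, 3, 4, 5, 4, 3, 0])
    (flowerMark [(.v, -3), (.x, -3), (.z, -2), (.z, -1), (.z, 1), (.z, 2)]) := by decide +kernel

theorem isFlowerExponent_seven : IsFlowerExponent 3
    (flowerTable 3 [2, 2, 3, 4, 3, 2, 1] [2, 2, 3, 4, 3, 2, 1] [2, 2, 2, 3, 3, 2, 1]
      [2, 2, 3, 4, 4, 3, 0])
    (flowerMark [(.v, -3), (.x, -3), (.y, -3), (.y, -2), (.z, -3), (.z, -2), (.z, -1), (.z, 1),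
      (.z, 2)]) := by decide +kernel

/-- The neighbours of a vertex. -/
def flowerNeighbors (k : ℕ) (p : FlowerKind × ℤ) : List (FlowerKind × ℤ) :=
  if p.1 = .z then [(.v, p.2), (.x, p.2), (.y, p.2)]
  else [(.z, p.2), if p.2 = k then (p.1.swap, -k) else (p.1, p.2 + 1),
    if p.2 = -k then (p.1.swap, k) else (p.1, p.2 - 1)]

theorem mem_flowerNeighbors {k : ℕ} (hk : 1 ≤ k) {a b : FlowerVertex k}
    (h : (flowerSnark k).Adj a b) : (a.1, (a.2 : ℤ)) ∈ flowerNeighbors k (b.1, b.2) := by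
  obtain ⟨t, i, hi⟩ := a
  obtain ⟨t', j, hj⟩ := b
  have hi' := Finset.mem_Icc.1 hi
  have hj' := Finset.mem_Icc.1 hj
  rw [flowerSnark_adj_iff hk] at h
  cases t <;> cases t' <;>
    simp only [flowerArc, Subtype.mk.injEq, or_false, false_or] at h <;>
    simp [flowerNeighbors, FlowerKind.swap] <;> (try split_ifs) <;>
    first | omega | (simp; done) | (simp; omega)

/-- The demand before the last move to `p`, if that move came from `q`. -/
def undoDemand (p q : FlowerKind × ℤ) (N : FlowerKind × ℤ → ℕ) (a : FlowerKind × ℤ) : ℕ :=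
  N a - (if a = p then 1 else 0) + if a = q then 2 else 0

/-- The vertex of the Flower snark as a kind and an integer. -/
def flowerCoe {k : ℕ} (a : FlowerVertex k) : FlowerKind × ℤ := (a.1, a.2)

theorem flowerCoe_inj {k : ℕ} {a b : FlowerVertex k} : flowerCoe a = flowerCoe b ↔ a = b := by
  refine ⟨fun h : (a.1, (a.2 : ℤ)) = (b.1, (b.2 : ℤ)) => ?_, congrArg _⟩
  rw [Prod.mk.injEq] at h
  exact Prod.ext h.1 (Subtype.ext h.2)

/-- The demand of a single pebble on `p`. -/
def rootDemand (p q : FlowerKind × ℤ) : ℕ := if q = p then 1 else 0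

theorem PebblingSolvable.covers_flower {k : ℕ} {t : FlowerKind} {C : FlowerVertex k → ℕ}
    (h : PebblingSolvable (flowerSnark k) (flowerCenter k t) C) :
    PebblingCovers (flowerSnark k) C (fun a => rootDemand (t, 0) (flowerCoe a)) := by
  obtain ⟨C', hC, hN⟩ := h.covers
  refine ⟨C', hC, fun a => le_trans (le_of_eq ?_) (hN a)⟩
  simp only [rootDemand, Pi.single_apply, ← flowerCoe_inj]
  rfl

theorem PebblingCovers.undo_flower {k : ℕ} (hk : 1 ≤ k) {C : FlowerVertex k → ℕ}
    {N : FlowerKind × ℤ → ℕ} (h : PebblingCovers (flowerSnark k) C (fun a => N (flowerCoe a)))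
    (v : FlowerVertex k) (hv : C v < N (flowerCoe v)) :
    ∃ q ∈ flowerNeighbors k (flowerCoe v),
      PebblingCovers (flowerSnark k) C (fun a => undoDemand (flowerCoe v) q N (flowerCoe a)) := by
  obtain ⟨w, hw, h⟩ := h.undo hv
  refine ⟨flowerCoe w, mem_flowerNeighbors hk hw, ?_⟩
  simpa only [undoDemand, flowerCoe_inj] using h

theorem not_solvable_configFive :
    ¬ PebblingSolvable (flowerSnark 2) (flowerCenter 2 .v) configFive := by
  intro h
  have h0 := h.covers_flower
  obtain ⟨q, hq, h1⟩ := h0.undo_flower (k := 2) (by norm_num) (.v, ⟨0, by decide⟩) (by decide +kernel)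
  have hq : q ∈ [(FlowerKind.z, 0), (.v, 1), (.v, -1)] := hq
  simp only [List.mem_cons, List.not_mem_nil, or_false] at hq
  rcases hq with rfl | rfl | rfl
  -- Here only the stack of `15` counts, while two pebbles on `z_0` or on `v_1` are worth `16`.
  · exact absurd (isFlowerExponent_five.value_le (by norm_num) h1) (by decide +kernel)
  · exact absurd (isFlowerExponent_five.value_le (by norm_num) h1) (by decide +kernel)
  -- Two pebbles on `v_{-1}` are worth only `8`, so this demand has to be traced back further.
  obtain ⟨q, hq, h2⟩ := h1.undo_flower (k := 2) (by norm_num) (.v, ⟨-1, by decide⟩) (by decide +kernel)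
  have hq : q ∈ [(FlowerKind.z, -1), (.v, 0), (.v, -2)] := hq
  simp only [List.mem_cons, List.not_mem_nil, or_false] at hq
  rcases hq with rfl | rfl | rfl
  · obtain ⟨q, hq, h3⟩ := h2.undo_flower (k := 2) (by norm_num) (.v, ⟨-1, by decide⟩) (by decide +kernel)
    have hq : q ∈ [(FlowerKind.z, -1), (.v, 0), (.v, -2)] := hq
    simp only [List.mem_cons, List.not_mem_nil, or_false] at hq
    rcases hq with rfl | rfl | rfl
    · exact absurd (isFlowerExponent_five_hub.value_le (by norm_num) h3) (by decide +kernel)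
    · exact absurd (isFlowerExponent_five.value_le (by norm_num) h3) (by decide +kernel)
    · exact absurd (isFlowerExponent_five_rim.value_le (by norm_num) h3) (by decide +kernel)
  · exact absurd (isFlowerExponent_five.value_le (by norm_num) h2) (by decide +kernel)
  · exact absurd (isFlowerExponent_five_rim.value_le (by norm_num) h2) (by decide +kernel)

theorem not_solvable_configSeven :
    ¬ PebblingSolvable (flowerSnark 3) (flowerCenter 3 .z) configSeven := by
  intro h
  have h0 := h.covers_flower
  obtain ⟨q, hq, h1⟩ := h0.undo_flower (k := 3) (by norm_num) (.z, ⟨0, by decide⟩) (by decide +kernel)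
  have hq : q ∈ [(FlowerKind.v, 0), (.x, 0), (.y, 0)] := hq
  simp only [List.mem_cons, List.not_mem_nil, or_false] at hq
  rcases hq with rfl | rfl | rfl
  · exact absurd (isFlowerExponent_seven.value_le (by norm_num) h1) (by decide +kernel)
  · exact absurd (isFlowerExponent_seven.value_le (by norm_num) h1) (by decide +kernel)
  obtain ⟨q, hq, h2⟩ := h1.undo_flower (k := 3) (by norm_num) (.y, ⟨0, by decide⟩) (by decide +kernel)
  have hq : q ∈ [(FlowerKind.z, 0), (.y, 1), (.y, -1)] := hq
  simp only [List.mem_cons, List.not_mem_nil, or_false] at hq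
  rcases hq with rfl | rfl | rfl
  · exact absurd (isFlowerExponent_seven.value_le (by norm_num) h2) (by decide +kernel)
  -- Two pebbles on `y_1` and one on `y_0` are worth `24`, below the stack of `31`; the remaining
  -- pebble on `y_0` must be traced as well.
  · obtain ⟨q, hq, h3⟩ := h2.undo_flower (k := 3) (by norm_num) (.y, ⟨0, by decide⟩) (by decide +kernel)
    have hq : q ∈ [(FlowerKind.z, 0), (.y, 1), (.y, -1)] := hq
    simp only [List.mem_cons, List.not_mem_nil, or_false] at hq
    rcases hq with rfl | rfl | rfl
    · exact absurd (isFlowerExponent_seven.value_le (by norm_num) h3) (by decide +kernel)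
    · exact absurd (isFlowerExponent_seven.value_le (by norm_num) h3) (by decide +kernel)
    · exact absurd (isFlowerExponent_seven_path.value_le (by norm_num) h3) (by decide +kernel)
  · exact absurd (isFlowerExponent_seven_path.value_le (by norm_num) h2) (by decide +kernel)

end FlowerLowerBound

theorem theorem2 :
    pebblingNumber (flowerSnark 1) ≤ 13 ∧
    (23 ≤ pebblingNumber (flowerSnark 2) ∧ pebblingNumber (flowerSnark 2) ≤ 30) ∧
    (41 ≤ pebblingNumber (flowerSnark 3) ∧ pebblingNumber (flowerSnark 3) ≤ 61) ∧
    ∀ k : ℕ, 3 ≤ k →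
      ((2 ^ (k + 2) + 9 : ℕ) : ℕ∞) ≤ pebblingNumber (flowerSnark k) ∧
      pebblingNumber (flowerSnark k) ≤
        ((⌊(9 / 5 : ℝ) * 2 ^ (k + 2) + 2 * (k : ℝ) - 18 / 5⌋₊ + 1 : ℕ) : ℕ∞) := by
  have upper : ∀ k n : ℕ, 1 ≤ k → (9 / 5 : ℝ) * 2 ^ (k + 2) + 2 * (k : ℝ) - 18 / 5 < n →
      pebblingNumber (flowerSnark k) ≤ n := by
    intro k n hk h
    refine (pebblingNumber_flowerSnark_le hk).trans (Nat.cast_le.2 ?_)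
    have hn : n ≠ 0 := by
      rintro rfl
      have := two_le_two_pow hk
      have : (0 : ℝ) ≤ k := Nat.cast_nonneg k
      rw [pow_add] at h
      norm_num at h
      linarith
    exact (Nat.floor_lt' hn).2 h
  have seven : ((41 : ℕ) : ℕ∞) ≤ pebblingNumber (flowerSnark 3) :=
    le_pebblingNumber not_solvable_configSeven (by decide +kernel)
  refine ⟨upper 1 13 (by norm_num) (by norm_num),
    ⟨le_pebblingNumber (t := 23) not_solvable_configFive (by decide +kernel),
      upper 2 30 (by norm_num) (by norm_num)⟩,
    ⟨seven, upper 3 61 (by norm_num) (by norm_num)⟩,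
    fun k hk => ⟨?_, pebblingNumber_flowerSnark_le (by omega)⟩⟩
  -- The stack configuration gives `2 ^ (k + 2) + 2 * k + 2`, which is one short at `k = 3`, where
  -- the bound `41` for `J_7` takes over.
  rcases hk.eq_or_lt with rfl | hk
  · exact seven
  · exact (Nat.cast_le.2 (by omega)).trans (le_pebblingNumber_flowerSnark (by omega))
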